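/- Let $k\ge 1$ be an integer. For a finite set $A$ let $\omega\in\{\pm1\}^A$ be uniformly random, and for $\epsilon\in(0,1)$ let $\omega^\epsilon$ be obtained from $\omega$ by flipping the sign of each coordinate independently with probability $\epsilon$ (independently of $\omega$). A family of functions $f_n:\{\pm1\}^{A_n}\to\{\pm1\}$ is called noise stable if $\lim_{\epsilon\downarrow0}\sup_n \mathrm P\big(f_n(\omega)\ne f_n(\omega^\epsilon)\big)=0$. Tree-like graph. For $n\ge0$ let $G_n$ be the layered graph with nodes $v_{t,i}$, $0\le t\le n$, $|i|\le k(n-t)$, where for $t\ge1$ the children of $v_{t,i}$ are the $2k+1$ nodes $v_{t-1,j}$ with $|i-j|\le k$. Given $\omega\in\{\pm1\}^{\{-kn,\dots,kn\}}$, put $f(v_{0,j})=\omega(j)$, let $f(v_{t,i})$ for $t\ge1$ be the majority of the values of its children, and set $f_n(\omega)=f(v_{n,0})$. Cycle. For odd $n$ and $\omega_0=\omega\in\{\pm1\}^{\mathbb Z/n\mathbb Z}$ let $\omega_{t+1}(i)$ be the majority of the values $\omega_t(j)$ over the set of nodes $j\in\{i-k,\dots,i+k\}\bmod n$ (all $n$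 nodes if $n<2k+1$). For $T\ge 0$ let $g_{n,T}(\omega)$ be the majority of the $n$ values $\omega_T(i)$, $i\in\mathbb Z/n\mathbb Z$. Theorem (convolutional iterated $(2k+1)$-majority with stride $1$ is noise stable, with and without cyclical convention). The sequence $(f_n)_{n\ge0}$ is noise stable, and for every choice of depths $T_n\in\{0,1,2,\dots\}$ the sequence $(g_{n,T_n})_{n\text{ odd}}$ is noise stable. -/

import Mathlib

open Filter Topology MeasureTheory
open scoped ENNReal

/-- Majority of the `±1`-values `x i`, `i ∈ s`: the sign of their sum. It is only ever applied to
sets `s` of odd cardinality, for which the sum is never zero. -/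
def majorityOn {α : Type} (s : Finset α) (x : α → ℤˣ) : ℤˣ :=
  if 0 < ∑ i ∈ s, ((x i : ℤˣ) : ℤ) then 1 else -1

/-! ### Noise stability -/

instance signMeasurableSingletonClass : MeasurableSingletonClass ℤˣ where
  measurableSet_singleton u := ⟨{(u : ℤ)}, MeasurableSet.of_discrete, by
    ext v; simp [Units.ext_iff]⟩

/-- The law on `{1, -1}` giving mass `p` to `-1` and mass `1 - p` to `1`. -/
noncomputable def signLaw (p : ℝ) : Measure ℤˣ :=
  ENNReal.ofReal (1 - p) • Measure.dirac 1 + ENNReal.ofReal p • Measure.dirac (-1)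

/-- Joint law of a uniform vector `ω ∈ {±1}^α` and an independent vector `η` whose coordinates are
independent and equal to `-1` with probability `ε`. The noisy version of `ω` is the coordinatewise
product `ω * η`, in which each bit of `ω` is flipped independently with probability `ε`. -/
noncomputable def noiseLaw (α : Type) [Fintype α] (ε : ℝ) : Measure ((α → ℤˣ) × (α → ℤˣ)) :=
  (Measure.pi fun _ : α => signLaw (1 / 2)).prod (Measure.pi fun _ : α => signLaw ε)

/-- `P(f(ω) ≠ f(ω^ε))`. -/
noncomputable def disagreement {α : Type} [Fintype α] (f : (α → ℤˣ) → ℤˣ) (ε : ℝ) : ℝ≥0∞ :=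
  noiseLaw α ε {p | f p.1 ≠ f (p.1 * p.2)}

/-- A family of Boolean functions `f n : {±1}^(α n) → {±1}` is noise stable if
`lim_{ε → 0} sup_n P(f n (ω) ≠ f n (ω^ε)) = 0`. -/
def NoiseStable {ι : Type} {α : ι → Type} [∀ n, Fintype (α n)]
    (f : (n : ι) → (α n → ℤˣ) → ℤˣ) : Prop :=
  Tendsto (fun ε : ℝ => ⨆ n, disagreement (f n) ε) (𝓝[>] 0) (𝓝 0)

/-! ### The tree-like graph with stride one -/

/-- The layer `m` generations below the output node: the nodes `-km, …, km`. -/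
abbrev TreeLayer (k m : ℕ) : Type := {i : ℤ // i ∈ Finset.Icc (-((k : ℤ) * m)) ((k : ℤ) * m)}

/-- The children of node `i` are the nodes `j` of the layer below with `|i - j| ≤ k`. -/
noncomputable def treeChildren (k m : ℕ) (i : TreeLayer k m) : Finset (TreeLayer k (m + 1)) :=
  Finset.univ.filter fun j => ((i : ℤ) - (j : ℤ)).natAbs ≤ k

/-- The function computed by the network with `n` layers above its input layer `-kn, …, kn`:
every node takes the majority of its `2k+1` children, and the value of the single top node is
the output. -/
noncomputable def treeMajority (k : ℕ) : (n : ℕ) → (TreeLayer k n → ℤˣ) → ℤˣ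
  | 0, ω => ω ⟨0, by simp⟩
  | n + 1, ω => treeMajority k n fun i => majorityOn (treeChildren k n i) ω

/-! ### The cycle with stride one -/

/-- The children of node `i` of the `n`-cycle are the nodes `i - k, …, i + k` modulo `n`. -/
noncomputable def cycleChildren (k n : ℕ) (i : ZMod n) : Finset (ZMod n) :=
  (Finset.Icc (-(k : ℤ)) (k : ℤ)).image fun d : ℤ => i + (d : ZMod n)

/-- One layer of the network on the `n`-cycle. -/
noncomputable def cycleStep (k n : ℕ) (ω : ZMod n → ℤˣ) : ZMod n → ℤˣ :=
  fun i => majorityOn (cycleChildren k n i) ω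

/-- The function computed on the `n`-cycle: `T` layers of `2k+1`-majorities, followed by the
majority of all `n` values in the last layer. -/
noncomputable def cycleMajority (k T n : ℕ) [NeZero n] (ω : ZMod n → ℤˣ) : ℤˣ :=
  majorityOn Finset.univ ((cycleStep k n)^[T] ω)

instance oddNeZero (n : {n : ℕ // Odd n}) : NeZero (n : ℕ) := ⟨n.2.pos.ne'⟩

/-! A run of `k+1` equal values is frozen: each of its sites sees the whole run inside its window of
`2k+1` sites, so the run wins every majority. Windows have radius `k`, so no influence crosses such
a run. Once there is a run on each side of the origin within distance `L` (`Shielded`), the value at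
the origin at every later time is a function of the input on `[-L, L]` (`Shielded.iterate_congr`).
Disjoint runs are independent, so the origin fails to be shielded with probability exponentially
small in `L`, uniformly in the depth.

On the tree-like graph the output is the origin of the automaton on `ℤ` after `n` steps. Up to a
small probability only flips among `2L+1` inputs matter, which gives a bound `a + (2L+1)ε`.

On the cycle the output is the sign of the total sum `S` in the last layer. If the noise changes
this sign, then `|S| ≤ |S - S'|`, where `S'` is the noisy sum, and the two sides are compared at the
scale `δ√n`.

Upper bound for `|S - S'|` (`expect_sq_sum_siteChange_le`): for a fixed noise vector, the changes at
single sites are nearly local and odd under global negation, hence nearly uncorrelated at large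
distances. At short distances they vanish unless shielding fails or a nearby bit is flipped. The
second moment is thus a small multiple of `n` plus a constant times the number of flips.

Lower bound for `|S|` (`uniformProb_abs_totalSum_le`): in a cell of three constant blocks the outer
two shield the middle one, so reversing the middle block preserves the uniform law and alters the
evolution only on that block. There are linearly many such cells, so `S` contains a sum of order `n`
free random signs, and a binomial small ball estimate applies for every depth. -/

open scoped BigOperators

/-! ### Majority of signs -/

theorem unit_coe_le_one (u : ℤˣ) : (u : ℤ) ≤ 1 := by
  rcases Int.units_eq_one_or u with h | h <;> simp [h]

theorem neg_one_le_unit_coe (u : ℤˣ) : -1 ≤ (u : ℤ) := by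
  rcases Int.units_eq_one_or u with h | h <;> simp [h]

theorem majorityOn_eq_of_subset {α : Type} [DecidableEq α] {s t : Finset α} {x : α → ℤˣ} {u : ℤˣ}
    (hts : t ⊆ s) (hcard : s.card < 2 * t.card) (hx : ∀ i ∈ t, x i = u) : majorityOn s x = u := by
  have hsum : ∑ i ∈ s, ((x i : ℤˣ) : ℤ) = ∑ i ∈ s \ t, ((x i : ℤˣ) : ℤ) + t.card * (u : ℤ) := by
    rw [← Finset.sum_sdiff hts, Finset.sum_congr (s₁ := t) rfl fun i hi => by rw [hx i hi],
      Finset.sum_const, nsmul_eq_mul]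
  have hc : (s \ t).card + t.card = s.card := Finset.card_sdiff_add_card_eq_card hts
  have hup : ∑ i ∈ s \ t, ((x i : ℤˣ) : ℤ) ≤ (s \ t).card := by
    simpa using Finset.sum_le_card_nsmul (s \ t) (fun i => ((x i : ℤˣ) : ℤ)) 1
      fun i _ => unit_coe_le_one _
  have hlo : -((s \ t).card : ℤ) ≤ ∑ i ∈ s \ t, ((x i : ℤˣ) : ℤ) := by
    simpa using Finset.card_nsmul_le_sum (s \ t) (fun i => ((x i : ℤˣ) : ℤ)) (-1)
      fun i _ => neg_one_le_unit_coe _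
  unfold majorityOn
  rw [hsum]
  rcases Int.units_eq_one_or u with rfl | rfl
  · rw [if_pos]; simp; omega
  · rw [if_neg]; simp; omega

theorem majorityOn_congr {α : Type} {s : Finset α} {x y : α → ℤˣ} (h : ∀ i ∈ s, x i = y i) :
    majorityOn s x = majorityOn s y := by
  unfold majorityOn
  rw [Finset.sum_congr rfl fun i hi => by rw [h i hi]]

theorem odd_sum_units {α : Type} {s : Finset α} (hs : Odd s.card) (x : α → ℤˣ) :
    Odd (∑ i ∈ s, ((x i : ℤˣ) : ℤ)) := by
  have h : Even (∑ i ∈ s, (((x i : ℤˣ) : ℤ) - 1)) := by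
    refine Finset.even_sum _ fun i _ => ?_
    rcases Int.units_eq_one_or (x i) with h | h <;> simp [h]
  rw [Finset.sum_sub_distrib, Finset.sum_const, nsmul_eq_mul, mul_one] at h
  have hs' : Odd (s.card : ℤ) := by exact_mod_cast hs
  simpa using h.add_odd hs'

/-- Odd cardinality rules out a zero sum, the one case where the tie rule would break the symmetry.
-/
theorem majorityOn_neg {α : Type} {s : Finset α} (hs : Odd s.card) (x : α → ℤˣ) :
    majorityOn s (-x) = -majorityOn s x := by
  have h := odd_sum_units hs x
  have h0 : ∑ i ∈ s, ((x i : ℤˣ) : ℤ) ≠ 0 := by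
    intro h0; rw [h0] at h; simp at h
  unfold majorityOn
  simp only [Pi.neg_apply, Units.val_neg, Finset.sum_neg_distrib]
  split_ifs <;> first | omega | simp

theorem majorityOn_image {α β : Type} [DecidableEq β] {s : Finset α} {g : α → β}
    (hg : Set.InjOn g s) (x : β → ℤˣ) : majorityOn (s.image g) x = majorityOn s (x ∘ g) := by
  unfold majorityOn
  rw [Finset.sum_image hg]; rfl

/-! ### The majority cellular automaton on the integers -/

/-- One step of the `2k+1`-majority cellular automaton on `ℤ`. -/
noncomputable def lineStep (k : ℕ) (ζ : ℤ → ℤˣ) : ℤ → ℤˣ :=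
  fun i => majorityOn (Finset.Icc (i - k) (i + k)) ζ

/-- `ζ` is constant on the `k+1` sites `a, …, a + k`. -/
def ConstBlock (k : ℕ) (ζ : ℤ → ℤˣ) (a : ℤ) : Prop :=
  ∀ x ∈ Finset.Icc a (a + k), ζ x = ζ a

/-- The window of any site of the block contains the entire block, which is `k+1` of its `2k+1`
sites. -/
theorem lineStep_eq_of_constBlock {k : ℕ} {ζ : ℤ → ℤˣ} {a : ℤ} (h : ConstBlock k ζ a) {x : ℤ}
    (hx : x ∈ Finset.Icc a (a + k)) : lineStep k ζ x = ζ a := by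
  simp only [Finset.mem_Icc] at hx
  refine majorityOn_eq_of_subset (t := Finset.Icc a (a + k)) ?_ ?_ h
  · exact Finset.Icc_subset_Icc (by omega) (by omega)
  · simp only [Int.card_Icc]; omega

theorem iterate_lineStep_eq_of_constBlock {k : ℕ} {ζ : ℤ → ℤˣ} {a : ℤ} (h : ConstBlock k ζ a)
    (T : ℕ) : ∀ x ∈ Finset.Icc a (a + k), (lineStep k)^[T] ζ x = ζ a := by
  induction T generalizing ζ with
  | zero => exact h
  | succ T ih =>
    have ha : a ∈ Finset.Icc a (a + k) := by simp
    intro x hx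
    rw [Function.iterate_succ_apply, ih _ x hx, lineStep_eq_of_constBlock h ha]
    intro y hy
    rw [lineStep_eq_of_constBlock h hy, lineStep_eq_of_constBlock h ha]

/-- Two configurations which agree on a set `V` protected by constant blocks agree on `V` for
all times. -/
theorem iterate_lineStep_congr {k : ℕ} {ζ ξ : ℤ → ℤˣ} {V : Set ℤ} (hV : ∀ x ∈ V, ζ x = ξ x)
    (hb : ∀ x ∈ V, (∃ a : ℤ, x ∈ Finset.Icc a (a + k) ∧ ConstBlock k ζ a ∧
      ∀ y ∈ Finset.Icc a (a + k), y ∈ V) ∨ ∀ y ∈ Finset.Icc (x - k) (x + k), y ∈ V)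
    (T : ℕ) : ∀ x ∈ V, (lineStep k)^[T] ζ x = (lineStep k)^[T] ξ x := by
  induction T with
  | zero => exact hV
  | succ T ih =>
    intro x hx
    -- A block inside `V` is constant with the same value for both configurations, hence frozen in
    -- both. A site whose window lies in `V` is handled by induction on time.
    rcases hb x hx with ⟨a, hxa, hc, haV⟩ | hw
    · have ha : a ∈ Finset.Icc a (a + k) := by simp
      have hc' : ConstBlock k ξ a := fun y hy => by
        rw [← hV y (haV y hy), ← hV a (haV a ha), hc y hy]
      rw [iterate_lineStep_eq_of_constBlock hc _ x hxa,
        iterate_lineStep_eq_of_constBlock hc' _ x hxa, hV a (haV a ha)]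
    · simp only [Function.iterate_succ_apply']
      exact majorityOn_congr fun y hy => ih y (hw y hy)

theorem lineStep_neg (k : ℕ) (ζ : ℤ → ℤˣ) : lineStep k (-ζ) = -lineStep k ζ := by
  funext i
  refine majorityOn_neg ?_ ζ
  rw [Int.card_Icc]
  exact ⟨k, by omega⟩

theorem iterate_lineStep_neg (k T : ℕ) (ζ : ℤ → ℤˣ) :
    (lineStep k)^[T] (-ζ) = -(lineStep k)^[T] ζ := by
  induction T with
  | zero => rfl
  | succ T ih => rw [Function.iterate_succ_apply', Function.iterate_succ_apply', ih, lineStep_neg]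

/-- `ζ` has constant blocks in `[-L, 0]` and in `[0, L]`. -/
def Shielded (k L : ℕ) (ζ : ℤ → ℤˣ) : Prop :=
  (∃ a : ℤ, -(L : ℤ) ≤ a ∧ a + k ≤ 0 ∧ ConstBlock k ζ a) ∧
    ∃ b : ℤ, 0 ≤ b ∧ b + k ≤ L ∧ ConstBlock k ζ b

theorem ConstBlock.congr {k : ℕ} {ζ ξ : ℤ → ℤˣ} {a : ℤ} (h : ConstBlock k ζ a)
    (hζ : ∀ x ∈ Finset.Icc a (a + k), ζ x = ξ x) : ConstBlock k ξ a := fun x hx => by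
  rw [← hζ x hx, ← hζ a (by simp), h x hx]

theorem Shielded.congr {k L : ℕ} {ζ ξ : ℤ → ℤˣ} (h : Shielded k L ζ)
    (hζ : ∀ x ∈ Finset.Icc (-(L : ℤ)) L, ζ x = ξ x) : Shielded k L ξ := by
  obtain ⟨⟨a, ha, ha', hA⟩, b, hb, hb', hB⟩ := h
  refine ⟨⟨a, ha, ha', hA.congr fun x hx => hζ x ?_⟩, b, hb, hb', hB.congr fun x hx => hζ x ?_⟩ <;>
  · simp only [Finset.mem_Icc] at hx ⊢; omega

theorem shielded_neg {k L : ℕ} {ζ : ℤ → ℤˣ} : Shielded k L (-ζ) ↔ Shielded k L ζ := by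
  simp [Shielded, ConstBlock]

/-- The protected set is the interval spanned by the two blocks. A site strictly between them cannot
see past either one, since a block is wider than the radius `k`. -/
theorem Shielded.iterate_congr {k L : ℕ} {ζ ξ : ℤ → ℤˣ} (h : Shielded k L ζ)
    (hζ : ∀ x ∈ Finset.Icc (-(L : ℤ)) L, ζ x = ξ x) (T : ℕ) :
    (lineStep k)^[T] ζ 0 = (lineStep k)^[T] ξ 0 := by
  obtain ⟨⟨a, ha, ha', hA⟩, b, hb, hb', hB⟩ := h
  refine iterate_lineStep_congr (V := {x | a ≤ x ∧ x ≤ b + k}) ?_ ?_ T 0 ?_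
  · rintro x ⟨h1, h2⟩
    exact hζ x (by simp only [Finset.mem_Icc]; omega)
  · rintro x ⟨h1, h2⟩
    simp only [Finset.mem_Icc, Set.mem_ofPred_eq]
    by_cases hxa : x ≤ a + k
    · exact Or.inl ⟨a, ⟨h1, hxa⟩, hA, fun y hy => by omega⟩
    by_cases hxb : b ≤ x
    · exact Or.inl ⟨b, ⟨hxb, h2⟩, hB, fun y hy => by omega⟩
    · exact Or.inr fun y hy => by omega
  · show a ≤ 0 ∧ 0 ≤ b + k
    omega

/-! ### The two networks in terms of the automaton -/

/-- Each layer extends the one above by `k` sites on both sides, so every window is complete and the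
values of `ζ` outside the input layer are never read. -/
theorem treeMajority_eq_iterate (k n : ℕ) (ζ : ℤ → ℤˣ) :
    treeMajority k n (fun i => ζ i) = (lineStep k)^[n] ζ 0 := by
  induction n generalizing ζ with
  | zero => rfl
  | succ n ih =>
    rw [Function.iterate_succ_apply, ← ih, treeMajority]
    congr 1
    funext i
    unfold lineStep
    have : Finset.Icc ((i : ℤ) - k) (i + k) = (treeChildren k n i).image Subtype.val := by
      ext x
      have := i.2
      simp only [Finset.mem_Icc] at this
      simp only [Finset.mem_Icc, treeChildren, Finset.mem_image, Finset.mem_filter,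
        Finset.mem_univ, true_and, Subtype.exists, exists_and_right, exists_eq_right]
      push_cast
      constructor
      · intro h
        exact ⟨by constructor <;> nlinarith, by omega⟩
      · rintro ⟨h1, h2⟩
        omega
    rw [this, majorityOn_image Subtype.val_injective.injOn]
    rfl

theorem intCast_injOn_of_lt {n : ℕ} {a b : ℤ} (h : b - a < n) (c : ZMod n) :
    Set.InjOn (fun d : ℤ => c + (d : ZMod n)) (Finset.Icc a b) := by
  intro x hx y hy hxy
  simp only [Finset.coe_Icc, Set.mem_Icc] at hx hy
  have h1 : ((x : ℤ) : ZMod n) = y := add_left_cancel hxy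
  rw [ZMod.intCast_eq_intCast_iff_dvd_sub] at h1
  have := Int.eq_zero_of_abs_lt_dvd h1 (by rw [abs_lt]; omega)
  omega

/-- Unrolling the cycle from `c` commutes with one step; `2k < n` makes the `2k+1` children
distinct. -/
theorem cycleStep_apply {k n : ℕ} (hn : 2 * k < n) (ω : ZMod n → ℤˣ) (c : ZMod n) (x : ℤ) :
    cycleStep k n ω (c + x) = lineStep k (fun s : ℤ => ω (c + s)) x := by
  unfold cycleStep lineStep cycleChildren
  rw [majorityOn_image (intCast_injOn_of_lt (by omega) _)]
  have : Finset.Icc (x - k) (x + k) = (Finset.Icc (-(k : ℤ)) k).image fun d => x + d := by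
    ext y
    simp only [Finset.mem_Icc, Finset.mem_image]
    constructor
    · intro h; exact ⟨y - x, by omega, by omega⟩
    · rintro ⟨d, h, rfl⟩; omega
  rw [this, majorityOn_image (add_right_injective x).injOn]
  refine majorityOn_congr fun d _ => ?_
  simp [add_assoc]

theorem iterate_cycleStep_apply {k n : ℕ} (hn : 2 * k < n) (T : ℕ) (ω : ZMod n → ℤˣ) (c : ZMod n)
    (x : ℤ) : (cycleStep k n)^[T] ω (c + x) = (lineStep k)^[T] (fun s : ℤ => ω (c + s)) x := by
  induction T generalizing ω with
  | zero => rfl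
  | succ T ih =>
    rw [Function.iterate_succ_apply, Function.iterate_succ_apply, ih]
    exact congrFun (congrArg _ (funext fun s => cycleStep_apply hn ω c s)) x

/-! ### Uniform probabilities -/

open Classical in
/-- The probability of `p` under the uniform distribution on a finite type. -/
noncomputable def uniformProb {Ω : Type} [Fintype Ω] (p : Ω → Prop) : ℝ :=
  𝔼 ω, if p ω then (1 : ℝ) else 0

section Uniform

variable {Ω : Type} [Fintype Ω]

theorem uniformProb_nonneg (p : Ω → Prop) : 0 ≤ uniformProb p :=
  Finset.expect_nonneg fun _ _ => by split_ifs <;> norm_num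

theorem uniformProb_mono {p q : Ω → Prop} (h : ∀ ω, p ω → q ω) :
    uniformProb p ≤ uniformProb q := by
  refine Finset.expect_le_expect fun ω _ => ?_
  by_cases hp : p ω
  · simp [hp, h ω hp]
  · simp only [hp, if_false]; split_ifs <;> norm_num

theorem uniformProb_le_one [Nonempty Ω] (p : Ω → Prop) : uniformProb p ≤ 1 := by
  refine Finset.expect_le Finset.univ_nonempty fun ω _ => ?_
  split_ifs <;> norm_num

theorem uniformProb_or_le (p q : Ω → Prop) :
    uniformProb (fun ω => p ω ∨ q ω) ≤ uniformProb p + uniformProb q := by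
  unfold uniformProb
  rw [← Finset.expect_add_distrib]
  refine Finset.expect_le_expect fun ω _ => ?_
  by_cases hp : p ω <;> by_cases hq : q ω <;> simp [hp, hq]

theorem uniformProb_not [Nonempty Ω] (p : Ω → Prop) :
    uniformProb (fun ω => ¬ p ω) = 1 - uniformProb p := by
  unfold uniformProb
  rw [← Fintype.expect_one (ι := Ω), ← Finset.expect_sub_distrib]
  refine Finset.expect_congr rfl fun ω _ => ?_
  by_cases hp : p ω <;> simp [hp]

theorem uniformProb_equiv {Ω' : Type} [Fintype Ω'] (e : Ω ≃ Ω') (p : Ω' → Prop) :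
    uniformProb (fun ω => p (e ω)) = uniformProb p :=
  Fintype.expect_equiv e _ _ fun _ => rfl

theorem uniformProb_eq_card_div (p : Ω → Prop) [DecidablePred p] :
    uniformProb p = (Finset.univ.filter p).card / Fintype.card Ω := by
  unfold uniformProb
  rw [Fintype.expect_eq_sum_div_card, ← Finset.sum_boole]
  congr!

/-- Markov's inequality for the second moment. -/
theorem uniformProb_le_expect_sq_div (F : Ω → ℝ) {r : ℝ} (hr : 0 < r) :
    uniformProb (fun ω => r ≤ |F ω|) ≤ (𝔼 ω, F ω ^ 2) / r ^ 2 := by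
  unfold uniformProb
  rw [Finset.expect_div]
  refine Finset.expect_le_expect fun ω _ => ?_
  split_ifs with h
  · rw [one_le_div (by positivity), ← sq_abs (F ω)]
    gcongr
  · positivity

end Uniform

section Product

variable {α : Type} [Fintype α] [DecidableEq α]

/-- Functions of disjoint sets of coordinates are independent. -/
theorem expect_mul_of_disjoint {β : Type} [Fintype β] [Nonempty β] {s t : Set α}
    (hst : Disjoint s t)
    {F G : (α → β) → ℝ} (hF : ∀ ω ω', (∀ x ∈ s, ω x = ω' x) → F ω = F ω')
    (hG : ∀ ω ω', (∀ x ∈ t, ω x = ω' x) → G ω = G ω') :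
    𝔼 ω, F ω * G ω = (𝔼 ω, F ω) * 𝔼 ω, G ω := by
  classical
  have hswap : ∀ p : (α → β) × (α → β),
      F p.1 * G p.2 = (F * G) (fun x => if x ∈ s then p.1 x else p.2 x) := by
    intro p
    simp only [Pi.mul_apply]
    congr 1
    · exact hF _ _ fun x hx => by simp [hx]
    · exact hG _ _ fun x hx => by simp [Set.disjoint_right.1 hst hx]
  -- Two independent copies exchange their coordinates outside `s`. This involution turns `F` of the
  -- first copy times `G` of the second into `F * G` of a single copy.
  let e : (α → β) × (α → β) ≃ (α → β) × (α → β) :=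
    Function.Involutive.toPerm
      (fun p => (fun x => if x ∈ s then p.1 x else p.2 x, fun x => if x ∈ s then p.2 x else p.1 x))
      (by intro p; ext x <;> by_cases hx : x ∈ s <;> simp [hx])
  have h1 : 𝔼 p : (α → β) × (α → β), F p.1 * G p.2 = 𝔼 p : (α → β) × (α → β), (F * G) p.1 :=
    Fintype.expect_equiv e _ _ hswap
  have h2 : 𝔼 p : (α → β) × (α → β), F p.1 * G p.2 = (𝔼 ω, F ω) * 𝔼 ω, G ω := by
    rw [← Finset.univ_product_univ, Finset.expect_product' (f := fun a b => F a * G b),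
      Finset.expect_mul_expect]
  have h3 : 𝔼 p : (α → β) × (α → β), (F * G) p.1 = 𝔼 ω, F ω * G ω := by
    rw [← Finset.univ_product_univ, Finset.expect_product' (f := fun a _ => (F * G) a)]
    simp
  rw [← h2, h1, h3]

theorem uniformProb_and_of_disjoint {β : Type} [Fintype β] [Nonempty β] {s t : Set α}
    (hst : Disjoint s t)
    {p q : (α → β) → Prop} (hp : ∀ ω ω', (∀ x ∈ s, ω x = ω' x) → (p ω ↔ p ω'))
    (hq : ∀ ω ω', (∀ x ∈ t, ω x = ω' x) → (q ω ↔ q ω')) :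
    uniformProb (fun ω => p ω ∧ q ω) = uniformProb p * uniformProb q := by
  classical
  unfold uniformProb
  rw [← expect_mul_of_disjoint hst]
  · refine Finset.expect_congr rfl fun ω _ => ?_
    by_cases h1 : p ω <;> by_cases h2 : q ω <;> simp [h1, h2]
  · intro ω ω' h; simp [hp ω ω' h]
  · intro ω ω' h; simp [hq ω ω' h]

theorem uniformProb_apply_eq_one (x : α) :
    uniformProb (fun ω : α → ℤˣ => ω x = 1) = 1 / 2 := by
  classical
  have h1 := uniformProb_not (fun ω : α → ℤˣ => ω x = 1)
  have h2 := uniformProb_equiv (Equiv.neg (α → ℤˣ)) (fun ω : α → ℤˣ => ω x = 1)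
  have h3 : (fun ω : α → ℤˣ => ¬ ω x = 1) = fun ω => (Equiv.neg (α → ℤˣ)) ω x = 1 := by
    funext ω
    rcases Int.units_eq_one_or (ω x) with h | h <;> simp [h]
  rw [h3, h2] at h1
  linarith

theorem uniformProb_eq_one_on (s : Finset α) :
    uniformProb (fun ω : α → ℤˣ => ∀ x ∈ s, ω x = 1) = (1 / 2) ^ s.card := by
  classical
  induction s using Finset.induction_on with
  | empty => simp [uniformProb]
  | insert a s ha ih =>
    rw [Finset.card_insert_of_notMem ha, pow_succ', ← ih, ← uniformProb_apply_eq_one a,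
      ← uniformProb_and_of_disjoint (s := {a}) (t := (s : Set α))]
    · simp
    · simpa using ha
    · intro ω ω' h; simp [h a rfl]
    · intro ω ω' h
      exact forall₂_congr fun x hx => by rw [h x hx]

end Product

/-! ### Constant blocks are frequent -/

section Blocks

variable {α : Type} [Fintype α] [DecidableEq α]

theorem constBlock_congr {k : ℕ} {ζ ξ : ℤ → ℤˣ} {a : ℤ}
    (h : ∀ x ∈ Finset.Icc a (a + k), ζ x = ξ x) : ConstBlock k ζ a ↔ ConstBlock k ξ a :=
  ⟨fun hc => hc.congr h, fun hc => hc.congr fun x hx => (h x hx).symm⟩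

/-- Only the all-ones pattern is counted. Injectivity of `φ` is not needed, since the image of the
block has at most `k+1` points. -/
theorem uniformProb_not_constBlock_le (k : ℕ) (φ : ℤ → α) (a : ℤ) :
    uniformProb (fun ω : α → ℤˣ => ¬ ConstBlock k (fun x => ω (φ x)) a) ≤
      1 - (1 / 2) ^ (k + 1) := by
  classical
  rw [uniformProb_not]
  have h1 : (1 / 2 : ℝ) ^ (k + 1) ≤ (1 / 2) ^ ((Finset.Icc a (a + k)).image φ).card := by
    refine pow_le_pow_of_le_one (by norm_num) (by norm_num) ?_
    refine Finset.card_image_le.trans ?_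
    simp only [Int.card_Icc]; omega
  rw [← uniformProb_eq_one_on] at h1
  have h2 := uniformProb_mono
    (p := fun ω : α → ℤˣ => ∀ x ∈ (Finset.Icc a (a + k)).image φ, ω x = 1)
    (q := fun ω : α → ℤˣ => ConstBlock k (fun x => ω (φ x)) a) (fun ω h x hx => by
      beta_reduce
      rw [h _ (Finset.mem_image_of_mem φ hx), h _ (Finset.mem_image_of_mem φ (by simp))])
  linarith

/-- The `q` consecutive blocks have disjoint images under `φ`, so their failures to be constant are
independent. -/
theorem uniformProb_no_constBlock_le (k : ℕ) (φ : ℤ → α) (c : ℤ) (q : ℕ)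
    (hφ : Set.InjOn φ (Set.Ico c (c + q * (k + 1)))) :
    uniformProb (fun ω : α → ℤˣ => ∀ j < q, ¬ ConstBlock k (fun x => ω (φ x)) (c + j * (k + 1))) ≤
      (1 - (1 / 2) ^ (k + 1)) ^ q := by
  induction q with
  | zero => simp [uniformProb]
  | succ q ih =>
    have hsub : Set.Ico c (c + q * (k + 1)) ⊆ Set.Ico c (c + (q + 1 : ℕ) * (k + 1)) :=
      Set.Ico_subset_Ico_right (by push_cast; nlinarith)
    rw [pow_succ]
    have hle : ((1 : ℝ) / 2) ^ (k + 1) ≤ 1 := pow_le_one₀ (by norm_num) (by norm_num)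
    refine le_trans (le_of_eq ?_) (mul_le_mul (ih (hφ.mono hsub))
      (uniformProb_not_constBlock_le k φ (c + q * (k + 1))) (uniformProb_nonneg _)
      (pow_nonneg (by linarith) q))
    rw [← uniformProb_and_of_disjoint (s := φ '' Set.Ico c (c + q * (k + 1)))
      (t := φ '' Set.Icc (c + q * (k + 1)) (c + q * (k + 1) + k))]
    · congr 1
      funext ω
      simp only [Nat.lt_succ_iff_lt_or_eq, or_imp, forall_and, forall_eq]
    · rw [Set.disjoint_left]
      rintro _ ⟨x, hx, rfl⟩ ⟨y, hy, hxy⟩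
      have hx' := hx
      simp only [Set.mem_Ico] at hx
      simp only [Set.mem_Icc] at hy
      have := hφ (by simp only [Set.mem_Ico]; push_cast; constructor <;> nlinarith) (hsub hx') hxy
      omega
    · intro ω ω' h
      refine forall₂_congr fun j hj => not_congr (constBlock_congr fun x hx => h _ ⟨x, ?_, rfl⟩)
      simp only [Finset.mem_Icc] at hx
      have hj' : (j : ℤ) + 1 ≤ q := by exact_mod_cast hj
      simp only [Set.mem_Ico]
      constructor <;> nlinarith
    · intro ω ω' h
      refine not_congr (constBlock_congr fun x hx => h _ ⟨x, ?_, rfl⟩)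
      simpa using hx

theorem uniformProb_not_shielded_le (k L : ℕ) (φ : ℤ → α)
    (hφ : Set.InjOn φ (Set.Icc (-(L : ℤ)) L)) :
    uniformProb (fun ω : α → ℤˣ => ¬ Shielded k L (fun x => ω (φ x))) ≤
      2 * (1 - (1 / 2) ^ (k + 1)) ^ (L / (k + 1)) := by
  set q := L / (k + 1) with hq
  have hqL : q * (k + 1) ≤ L := Nat.div_mul_le_self _ _
  have hqL' : (q : ℤ) * (k + 1) ≤ L := by exact_mod_cast hqL
  have hj : ∀ j < q, (j : ℤ) * (k + 1) + k + 1 ≤ q * (k + 1) := fun j hj => by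
    have : (j : ℤ) + 1 ≤ q := by exact_mod_cast hj
    nlinarith
  have h1 := uniformProb_no_constBlock_le k φ (-L) q (hφ.mono fun x hx => by
    simp only [Set.mem_Ico, Set.mem_Icc] at hx ⊢; omega)
  have h2 := uniformProb_no_constBlock_le k φ 0 q (hφ.mono fun x hx => by
    simp only [Set.mem_Ico, Set.mem_Icc] at hx ⊢; omega)
  have h3 := uniformProb_mono (p := fun ω : α → ℤˣ => ¬ Shielded k L (fun x => ω (φ x)))
    (q := fun ω : α → ℤˣ =>
      (∀ j < q, ¬ ConstBlock k (fun x => ω (φ x)) (-(L : ℤ) + j * (k + 1))) ∨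
        ∀ j < q, ¬ ConstBlock k (fun x => ω (φ x)) (0 + j * (k + 1))) (by
    intro ω
    contrapose!
    rintro ⟨⟨i, hi, hiB⟩, j, hjq, hjB⟩
    have hi' := hj i hi
    have hj' := hj j hjq
    have hi0 : (0 : ℤ) ≤ i * (k + 1) := by positivity
    have hj0 : (0 : ℤ) ≤ j * (k + 1) := by positivity
    exact ⟨⟨_, by omega, by omega, hiB⟩, _, by omega, by omega, hjB⟩)
  have h4 := uniformProb_or_le
    (fun ω : α → ℤˣ => ∀ j < q, ¬ ConstBlock k (fun x => ω (φ x)) (-(L : ℤ) + j * (k + 1)))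
    (fun ω : α → ℤˣ => ∀ j < q, ¬ ConstBlock k (fun x => ω (φ x)) (0 + j * (k + 1)))
  linarith

end Blocks

/-! ### Averaging over the noise -/

theorem isProbabilityMeasure_signLaw {p : ℝ} (h0 : 0 ≤ p) (h1 : p ≤ 1) :
    IsProbabilityMeasure (signLaw p) := by
  refine ⟨?_⟩
  simp only [signLaw, Measure.coe_add, Measure.coe_smul, Pi.add_apply, Pi.smul_apply, measure_univ,
    smul_eq_mul, mul_one]
  rw [← ENNReal.ofReal_add (by linarith) h0]
  simp

theorem signLaw_singleton_neg_one (p : ℝ) : signLaw p {-1} = ENNReal.ofReal p := by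
  have : (1 : ℤˣ) ≠ -1 := by decide
  simp [signLaw, this]

theorem signLaw_half_singleton (u : ℤˣ) : signLaw (1 / 2) {u} = ENNReal.ofReal (1 / 2) := by
  have h : (1 : ℤˣ) ≠ -1 := by decide
  rcases Int.units_eq_one_or u with rfl | rfl
  · simp only [signLaw, Measure.coe_add, Measure.coe_smul, Pi.add_apply, Pi.smul_apply]
    norm_num [h.symm]
  · exact signLaw_singleton_neg_one _

section Noise

variable {α : Type} [Fintype α] [DecidableEq α]

theorem pi_signLaw_half_apply (p : (α → ℤˣ) → Prop) :
    (Measure.pi fun _ : α => signLaw (1 / 2)) {ω | p ω} = ENNReal.ofReal (uniformProb p) := by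
  classical
  have : IsProbabilityMeasure (signLaw (1 / 2)) :=
    isProbabilityMeasure_signLaw (by norm_num) (by norm_num)
  have h1 : ∀ ω : α → ℤˣ, (Measure.pi fun _ : α => signLaw (1 / 2)) {ω} =
      ENNReal.ofReal ((1 / 2) ^ Fintype.card α) := fun ω => by
    rw [Measure.pi_singleton, Finset.prod_congr rfl fun i _ => signLaw_half_singleton (ω i)]
    rw [Finset.prod_const, ENNReal.ofReal_pow (by norm_num), Finset.card_univ]
  have h2 : {ω | p ω} = ((Finset.univ.filter p : Finset (α → ℤˣ)) : Set (α → ℤˣ)) := by simp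
  rw [h2, ← sum_measure_singleton, Finset.sum_congr rfl fun ω _ => h1 ω, Finset.sum_const,
    uniformProb_eq_card_div, nsmul_eq_mul, ← ENNReal.ofReal_natCast,
    ← ENNReal.ofReal_mul (by positivity)]
  congr 1
  rw [Fintype.card_fun, Fintype.card_units_int]
  push_cast
  rw [one_div, inv_pow, div_eq_mul_inv]

open Classical in
/-- If, for every fixed noise vector, the probability of disagreement over the uniform input is
bounded by an affine function of the flipped coordinates, then this bound can be averaged. -/
theorem disagreement_le {f : (α → ℤˣ) → ℤˣ} {ε : ℝ} (h0 : 0 ≤ ε) (h1 : ε ≤ 1) {a : ℝ} {b : α → ℝ}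
    (ha : 0 ≤ a) (hb : ∀ x, 0 ≤ b x)
    (h : ∀ η : α → ℤˣ, uniformProb (fun ω => f ω ≠ f (ω * η)) ≤
      a + ∑ x, b x * if η x = -1 then 1 else 0) :
    disagreement f ε ≤ ENNReal.ofReal (a + ε * ∑ x, b x) := by
  have := isProbabilityMeasure_signLaw h0 h1
  have : IsProbabilityMeasure (signLaw (1 / 2)) :=
    isProbabilityMeasure_signLaw (by norm_num) (by norm_num)
  unfold disagreement noiseLaw
  -- Fubini with the noise as outer variable: the inner probability is the uniform one bounded in
  -- `h`.
  rw [Measure.prod_apply_symm (Set.toFinite _).measurableSet]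
  have hx : ∀ x : α, (Measure.pi fun _ : α => signLaw ε) {η | η x = -1} = ENNReal.ofReal ε := by
    intro x
    rw [← signLaw_singleton_neg_one ε,
      ← (measurePreserving_eval (fun _ : α => signLaw ε) x).measure_preimage
        (MeasurableSet.singleton _).nullMeasurableSet]
    rfl
  calc ∫⁻ η, (Measure.pi fun _ : α => signLaw (1 / 2))
        ((fun ω => (ω, η)) ⁻¹' {p | f p.1 ≠ f (p.1 * p.2)}) ∂(Measure.pi fun _ : α => signLaw ε)
      ≤ ∫⁻ η, (ENNReal.ofReal a + ∑ x, ENNReal.ofReal (b x) * {η | η x = -1}.indicator 1 η)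
          ∂Measure.pi fun _ : α => signLaw ε := by
        refine lintegral_mono fun η => ?_
        refine (pi_signLaw_half_apply fun ω => f ω ≠ f (ω * η)).le.trans ?_
        refine (ENNReal.ofReal_le_ofReal (h η)).trans ?_
        rw [ENNReal.ofReal_add ha (Finset.sum_nonneg fun x _ =>
          mul_nonneg (hb x) (by split_ifs <;> norm_num)),
          ENNReal.ofReal_sum_of_nonneg fun x _ =>
          mul_nonneg (hb x) (by split_ifs <;> norm_num)]
        gcongr with x
        rw [ENNReal.ofReal_mul (hb x)]
        gcongr
        by_cases hη : η x = -1 <;> simp [hη]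
    _ = ENNReal.ofReal a + ∑ x, ENNReal.ofReal (b x) * ENNReal.ofReal ε := by
        rw [lintegral_add_left measurable_const, lintegral_const, measure_univ, mul_one,
          lintegral_finsetSum _ fun x _ => measurable_of_finite _]
        congr 1
        refine Finset.sum_congr rfl fun x _ => ?_
        rw [lintegral_const_mul _ (measurable_of_finite _),
          lintegral_indicator_one (Set.toFinite _).measurableSet, hx]
    _ = ENNReal.ofReal (a + ε * ∑ x, b x) := by
        rw [ENNReal.ofReal_add ha (mul_nonneg h0 (Finset.sum_nonneg fun x _ => hb x)),
          Finset.mul_sum, ENNReal.ofReal_sum_of_nonneg fun x _ => mul_nonneg h0 (hb x)]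
        congr 1
        refine Finset.sum_congr rfl fun x _ => ?_
        rw [ENNReal.ofReal_mul h0, mul_comm]

open Classical in
theorem exists_flip_le_sum (s : Finset α) (η : α → ℤˣ) (h : ∃ x ∈ s, η x ≠ 1) :
    1 ≤ ∑ x, (if x ∈ s then (1 : ℝ) else 0) * if η x = -1 then 1 else 0 := by
  obtain ⟨x, hxs, hx⟩ := h
  have hx' : η x = -1 := (Int.units_eq_one_or _).resolve_left hx
  refine le_trans ?_ (Finset.single_le_sum (f := fun x => (if x ∈ s then (1 : ℝ) else 0) *
    if η x = -1 then 1 else 0) (fun y _ => by split_ifs <;> norm_num) (Finset.mem_univ x))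
  simp [hxs, hx']

/-- If `f` can only change when a site of `s` is flipped, up to an event of probability `a`, then
`f` and its noisy version differ with probability at most `a + ε |s|`. -/
theorem disagreement_le_of_local {f : (α → ℤˣ) → ℤˣ} {ε : ℝ} (h0 : 0 ≤ ε) (h1 : ε ≤ 1) {a : ℝ}
    (ha : 0 ≤ a) (s : Finset α)
    (h : ∀ η : α → ℤˣ, (∀ x ∈ s, η x = 1) → uniformProb (fun ω => f ω ≠ f (ω * η)) ≤ a) :
    disagreement f ε ≤ ENNReal.ofReal (a + ε * s.card) := by
  classical
  refine (disagreement_le (b := fun x => if x ∈ s then 1 else 0) h0 h1 ha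
    (fun x => by split_ifs <;> norm_num) fun η => ?_).trans (le_of_eq ?_)
  · by_cases hη : ∀ x ∈ s, η x = 1
    · refine (h η hη).trans (le_add_of_nonneg_right (Finset.sum_nonneg fun x _ => ?_))
      split_ifs <;> norm_num
    · push Not at hη
      have := exists_flip_le_sum s η hη
      have := uniformProb_le_one fun ω => f ω ≠ f (ω * η)
      linarith
  · congr 3
    simp

theorem disagreement_le_card (f : (α → ℤˣ) → ℤˣ) {ε : ℝ} (h0 : 0 ≤ ε) (h1 : ε ≤ 1) :
    disagreement f ε ≤ ENNReal.ofReal (ε * Fintype.card α) := by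
  have := disagreement_le_of_local (f := f) h0 h1 le_rfl Finset.univ fun η hη => by
    have : η = 1 := funext fun x => hη x (Finset.mem_univ x)
    simp [this, uniformProb]
  simpa using this

end Noise

/-- Noise stability follows from bounds of the form `a + C ε` with `a` arbitrarily small. -/
theorem noiseStable_of_forall {ι : Type} {α : ι → Type} [∀ n, Fintype (α n)]
    {f : (n : ι) → (α n → ℤˣ) → ℤˣ}
    (h : ∀ a : ℝ, 0 < a → ∃ C : ℝ, ∀ ε : ℝ, 0 < ε → ε ≤ 1 → ∀ n,
      disagreement (f n) ε ≤ ENNReal.ofReal (a + C * ε)) : NoiseStable f := by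
  unfold NoiseStable
  rw [ENNReal.tendsto_nhds_zero]
  intro δ hδ
  obtain ⟨a, ha, haδ⟩ : ∃ a : ℝ, 0 < a ∧ ENNReal.ofReal a < δ := by
    obtain ⟨q, hq, hqδ⟩ := ENNReal.lt_iff_exists_nnreal_btwn.1 hδ
    exact ⟨q, by exact_mod_cast hq, by simpa using hqδ⟩
  obtain ⟨C, hC⟩ := h (a / 2) (by linarith)
  have hlim : Tendsto (fun ε : ℝ => a / 2 + C * ε) (𝓝[>] 0) (𝓝 (a / 2)) := by
    have : Continuous fun ε : ℝ => a / 2 + C * ε := by fun_prop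
    simpa using (this.tendsto 0).mono_left nhdsWithin_le_nhds
  filter_upwards [hlim.eventually_lt_const (show a / 2 < a by linarith),
    Ioc_mem_nhdsGT (show (0 : ℝ) < 1 by norm_num)] with ε hε hε1
  refine iSup_le fun n => (hC ε hε1.1 hε1.2 n).trans ?_
  exact (ENNReal.ofReal_le_ofReal hε.le).trans haδ.le

theorem tendsto_shield_bound (k : ℕ) :
    Tendsto (fun L : ℕ => 2 * (1 - (1 / 2 : ℝ) ^ (k + 1)) ^ (L / (k + 1))) atTop (𝓝 0) := by
  have hpos : (0 : ℝ) < (1 / 2) ^ (k + 1) := by positivity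
  have hle : ((1 : ℝ) / 2) ^ (k + 1) ≤ 1 := pow_le_one₀ (by norm_num) (by norm_num)
  have h1 := (tendsto_pow_atTop_nhds_zero_of_lt_one (r := 1 - (1 / 2 : ℝ) ^ (k + 1))
    (by linarith) (by linarith)).const_mul 2
  rw [mul_zero] at h1
  exact h1.comp (Nat.tendsto_div_const_atTop (by omega))

/-! ### Noise stability on the tree-like graph. -/

theorem noiseStable_treeMajority (k : ℕ) : NoiseStable fun n : ℕ => treeMajority k n := by
  refine noiseStable_of_forall fun a ha => ?_
  obtain ⟨L, hL⟩ := ((tendsto_shield_bound k).eventually_lt_const ha).exists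
  refine ⟨2 * L + 1, fun ε h0 h1 n => ?_⟩
  -- A narrow input layer has at most `2L+1` sites, and a union bound over all flips suffices.
  by_cases hn : k * n < L
  · refine (disagreement_le_card _ h0.le h1).trans (ENNReal.ofReal_le_ofReal ?_)
    have : (Fintype.card (TreeLayer k n) : ℝ) ≤ 2 * L + 1 := by
      rw [Fintype.card_coe, Int.card_Icc]
      have : ((k : ℤ) * n + 1 - -((k : ℤ) * n)).toNat ≤ 2 * L + 1 := by
        have : (k : ℤ) * n < L := by exact_mod_cast hn
        omega
      exact_mod_cast this
    nlinarith
  · have hn' : (L : ℤ) ≤ k * n := by exact_mod_cast not_lt.1 hn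
    -- Extension of the input to `ℤ`; the default site used outside the layer has no effect on the
    -- output.
    let φ : ℤ → TreeLayer k n := fun s =>
      if h : s ∈ Finset.Icc (-((k : ℤ) * n)) ((k : ℤ) * n) then ⟨s, h⟩ else ⟨0, by simp; positivity⟩
    have hφ : ∀ s ∈ Finset.Icc (-((k : ℤ) * n)) ((k : ℤ) * n), (φ s : ℤ) = s := fun s hs => by
      simp only [φ, dif_pos hs]
    have hφ' : ∀ i : TreeLayer k n, φ i = i := fun i => Subtype.ext (hφ _ i.2)
    have hmem : ∀ s ∈ Set.Icc (-(L : ℤ)) L, s ∈ Finset.Icc (-((k : ℤ) * n)) ((k : ℤ) * n) := by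
      intro s hs
      simp only [Set.mem_Icc, Finset.mem_Icc] at hs ⊢
      omega
    have hinj : Set.InjOn φ (Set.Icc (-(L : ℤ)) L) := fun x hx y hy hxy => by
      rw [← hφ x (hmem x hx), ← hφ y (hmem y hy), hxy]
    have htree : ∀ ω : TreeLayer k n → ℤˣ,
        treeMajority k n ω = (lineStep k)^[n] (fun s => ω (φ s)) 0 := fun ω => by
      rw [← treeMajority_eq_iterate]
      simp only [hφ']
    have hcard : (((Finset.Icc (-(L : ℤ)) L).image φ).card : ℝ) ≤ 2 * L + 1 := by
      have : ((Finset.Icc (-(L : ℤ)) L).image φ).card ≤ 2 * L + 1 := by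
        refine Finset.card_image_le.trans ?_
        rw [Int.card_Icc]; omega
      exact_mod_cast this
    refine (disagreement_le_of_local h0.le h1 ha.le ((Finset.Icc (-(L : ℤ)) L).image φ)
      fun η hη => ?_).trans (ENNReal.ofReal_le_ofReal ?_)
    · refine (uniformProb_mono fun ω hω hs => ?_).trans
        ((uniformProb_not_shielded_le k L φ hinj).trans hL.le)
      refine hω ?_
      rw [htree, htree]
      refine Shielded.iterate_congr hs (fun x hx => ?_) n
      simp [hη _ (Finset.mem_image_of_mem φ hx)]
    · nlinarith

/-! ### Second moment of the change of the sum on the cycle -/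

/-- A bound for the probability that the origin is not shielded at distance `L`. -/
noncomputable def shieldBound (k L : ℕ) : ℝ := 2 * (1 - (1 / 2 : ℝ) ^ (k + 1)) ^ (L / (k + 1))

theorem shieldBase_mem (k : ℕ) : 0 < 1 - (1 / 2 : ℝ) ^ (k + 1) ∧ 1 - (1 / 2 : ℝ) ^ (k + 1) < 1 := by
  have h1 : (0 : ℝ) < (1 / 2) ^ (k + 1) := by positivity
  have h2 : (1 / 2 : ℝ) ^ (k + 1) < 1 := pow_lt_one₀ (by norm_num) (by norm_num) (by omega)
  constructor <;> linarith

theorem shieldBound_nonneg (k L : ℕ) : 0 ≤ shieldBound k L :=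
  mul_nonneg (by norm_num) (pow_nonneg (shieldBase_mem k).1.le _)

/-- Replaces the rounded exponent by a genuine geometric sequence, using `d ≤ c (⌊d/c⌋ + 1)`. -/
theorem pow_div_le {ρ : ℝ} (h0 : 0 < ρ) (h1 : ρ < 1) {c : ℕ} (hc : 0 < c) (d : ℕ) :
    ρ ^ (d / c) ≤ ρ⁻¹ * (ρ ^ (1 / c : ℝ)) ^ d := by
  have hc' : (0 : ℝ) < c := by exact_mod_cast hc
  rw [inv_mul_eq_div, le_div_iff₀ h0, ← pow_succ, ← Real.rpow_natCast, ← Real.rpow_natCast,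
    ← Real.rpow_mul h0.le]
  refine Real.rpow_le_rpow_of_exponent_ge h0 h1.le ?_
  rw [one_div, inv_mul_le_iff₀ hc']
  have := Nat.lt_mul_div_succ d hc
  exact_mod_cast this.le

theorem root_mem {ρ : ℝ} (h0 : 0 < ρ) (h1 : ρ < 1) {c : ℕ} (hc : 0 < c) :
    0 ≤ ρ ^ (1 / c : ℝ) ∧ ρ ^ (1 / c : ℝ) < 1 :=
  ⟨Real.rpow_nonneg h0.le _, Real.rpow_lt_one h0.le h1 (by positivity)⟩

theorem summable_shieldBound (k : ℕ) : Summable fun d => shieldBound k (d / 2) := by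
  obtain ⟨h0, h1⟩ := shieldBase_mem k
  have hc : 0 < 2 * (k + 1) := by omega
  obtain ⟨r0, r1⟩ := root_mem h0 h1 hc
  refine Summable.of_nonneg_of_le (fun d => shieldBound_nonneg k _) (fun d => ?_)
    (((summable_geometric_of_lt_one r0 r1).mul_left (1 - (1 / 2 : ℝ) ^ (k + 1))⁻¹).mul_left 2)
  unfold shieldBound
  rw [Nat.div_div_eq_div_mul]
  exact mul_le_mul_of_nonneg_left (pow_div_le h0 h1 hc d) (by norm_num)

theorem tendsto_mul_shieldBound (k : ℕ) :
    Tendsto (fun K : ℕ => (K : ℝ) * shieldBound k K) atTop (𝓝 0) := by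
  obtain ⟨h0, h1⟩ := shieldBase_mem k
  have hc : 0 < k + 1 := by omega
  obtain ⟨r0, r1⟩ := root_mem h0 h1 hc
  have hlim := (tendsto_self_mul_const_pow_of_lt_one r0 r1).const_mul
    (2 * (1 - (1 / 2 : ℝ) ^ (k + 1))⁻¹)
  rw [mul_zero] at hlim
  refine squeeze_zero (fun K => mul_nonneg K.cast_nonneg (shieldBound_nonneg k K)) (fun K => ?_) hlim
  have := mul_le_mul_of_nonneg_left (pow_div_le h0 h1 hc K) (show (0 : ℝ) ≤ 2 * K by positivity)
  unfold shieldBound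
  linarith

/-- The value of the origin after `T` steps, set to zero if the origin is not shielded. -/
noncomputable def shieldedValue (k T L : ℕ) (ζ : ℤ → ℤˣ) : ℝ :=
  open Classical in if Shielded k L ζ then (((lineStep k)^[T] ζ 0 : ℤˣ) : ℤ) else 0

theorem abs_unit_coe (u : ℤˣ) : |(((u : ℤˣ) : ℤ) : ℝ)| = 1 := by
  rcases Int.units_eq_one_or u with h | h <;> simp [h]

theorem abs_shieldedValue_le (k T L : ℕ) (ζ : ℤ → ℤˣ) : |shieldedValue k T L ζ| ≤ 1 := by
  unfold shieldedValue
  split_ifs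
  · rw [abs_unit_coe]
  · simp

theorem shieldedValue_neg (k T L : ℕ) (ζ : ℤ → ℤˣ) :
    shieldedValue k T L (-ζ) = -shieldedValue k T L ζ := by
  unfold shieldedValue
  by_cases h : Shielded k L ζ
  · rw [if_pos h, if_pos (shielded_neg.2 h), iterate_lineStep_neg]
    simp
  · rw [if_neg h, if_neg (mt shielded_neg.1 h), neg_zero]

/-- Being shielded is itself decided on `[-L, L]`, so the truncated value is exactly local. The
default value zero keeps it odd as well. -/
theorem shieldedValue_congr {k T L : ℕ} {ζ ξ : ℤ → ℤˣ}
    (h : ∀ x ∈ Finset.Icc (-(L : ℤ)) L, ζ x = ξ x) :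
    shieldedValue k T L ζ = shieldedValue k T L ξ := by
  unfold shieldedValue
  by_cases hs : Shielded k L ζ
  · rw [if_pos hs, if_pos (hs.congr h), hs.iterate_congr h]
  · rw [if_neg hs, if_neg fun hξ => hs (hξ.congr fun x hx => (h x hx).symm)]

theorem expect_eq_zero_of_odd {α : Type} [Fintype α] [DecidableEq α] {F : (α → ℤˣ) → ℝ}
    (hF : ∀ ω, F (-ω) = -F ω) : 𝔼 ω, F ω = 0 := by
  have h := Fintype.expect_equiv (Equiv.neg (α → ℤˣ)) (fun ω => -F ω) F fun ω => (hF ω).symm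
  rw [Finset.expect_neg_distrib] at h
  linarith

/-- At most two residues lie at a given cyclic distance from zero. -/
theorem sum_natAbs_valMinAbs_le {n : ℕ} [NeZero n] {G : ℕ → ℝ} (hG : ∀ d, 0 ≤ G d) :
    ∑ u : ZMod n, G u.valMinAbs.natAbs ≤ 2 * ∑ d ∈ Finset.range n, G d := by
  rw [Finset.sum_comp, Finset.mul_sum]
  refine (Finset.sum_le_sum (g := fun d => 2 * G d) fun d _ => ?_).trans
    (Finset.sum_le_sum_of_subset_of_nonneg ?_ fun d _ _ => mul_nonneg (by norm_num) (hG d))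
  · rw [nsmul_eq_mul]
    refine mul_le_mul_of_nonneg_right ?_ (hG d)
    have : (Finset.univ.filter fun u : ZMod n => u.valMinAbs.natAbs = d) ⊆
        {((d : ℤ) : ZMod n), ((-d : ℤ) : ZMod n)} := by
      intro u hu
      simp only [Finset.mem_filter, Finset.mem_univ, true_and] at hu
      rw [Finset.mem_insert, Finset.mem_singleton, ← u.coe_valMinAbs]
      rcases Int.natAbs_eq u.valMinAbs with h | h <;> rw [hu] at h
      · exact Or.inl (by rw [h])
      · exact Or.inr (by rw [h])
    exact_mod_cast (Finset.card_le_card this).trans Finset.card_le_two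
  · intro d hd
    obtain ⟨u, -, rfl⟩ := Finset.mem_image.1 hd
    have := u.natAbs_valMinAbs_le
    have := NeZero.pos n
    rw [Finset.mem_range]
    omega

/-! ### Covariances of the changes at two sites of the cycle. -/

section Cycle

variable {n : ℕ}

/-- The configuration on the cycle unrolled from the site `i`. -/
def unroll (ω : ZMod n → ℤˣ) (i : ZMod n) : ℤ → ℤˣ := fun s => ω (i + s)

theorem iterate_cycleStep_eq_unroll {k : ℕ} (hn : 2 * k < n) (T : ℕ) (ω : ZMod n → ℤˣ)
    (i : ZMod n) : (cycleStep k n)^[T] ω i = (lineStep k)^[T] (unroll ω i) 0 := by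
  have := iterate_cycleStep_apply hn T ω i 0
  rwa [Int.cast_zero, add_zero] at this

theorem uniformProb_not_shielded_unroll_le [NeZero n] (k : ℕ) {L : ℕ} (hL : 2 * L < n) (i : ZMod n) :
    uniformProb (fun ω : ZMod n → ℤˣ => ¬ Shielded k L (unroll ω i)) ≤ shieldBound k L :=
  uniformProb_not_shielded_le k L (fun s : ℤ => i + (s : ZMod n)) (by
    simpa using intCast_injOn_of_lt (a := -(L : ℤ)) (b := L) (by omega) i)

theorem uniformProb_not_shielded_unroll_mul_le [NeZero n] (k : ℕ) {L : ℕ} (hL : 2 * L < n) (i : ZMod n)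
    (η : ZMod n → ℤˣ) :
    uniformProb (fun ω : ZMod n → ℤˣ => ¬ Shielded k L (unroll (ω * η) i)) ≤ shieldBound k L :=
  (uniformProb_equiv (Equiv.mulRight η)
    fun ω : ZMod n → ℤˣ => ¬ Shielded k L (unroll ω i)).le.trans
    (uniformProb_not_shielded_unroll_le k hL i)

/-- The change of the value of site `i` at time `T` caused by the noise `η`. -/
noncomputable def siteChange (k T : ℕ) (η : ZMod n → ℤˣ) (i : ZMod n) (ω : ZMod n → ℤˣ) : ℝ :=
  (((cycleStep k n)^[T] ω i : ℤˣ) : ℤ) - (((cycleStep k n)^[T] (ω * η) i : ℤˣ) : ℤ)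

/-- The localized version of `siteChange`. -/
noncomputable def localChange (k T L : ℕ) (η : ZMod n → ℤˣ) (i : ZMod n) (ω : ZMod n → ℤˣ) : ℝ :=
  shieldedValue k T L (unroll ω i) - shieldedValue k T L (unroll (ω * η) i)

theorem abs_siteChange_le (k T : ℕ) (η : ZMod n → ℤˣ) (i : ZMod n) (ω : ZMod n → ℤˣ) :
    |siteChange k T η i ω| ≤ 2 := by
  refine (abs_sub _ _).trans ?_
  rw [abs_unit_coe, abs_unit_coe]; norm_num

theorem abs_localChange_le (k T L : ℕ) (η : ZMod n → ℤˣ) (i : ZMod n) (ω : ZMod n → ℤˣ) :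
    |localChange k T L η i ω| ≤ 2 := by
  refine (abs_sub _ _).trans ?_
  linarith [abs_shieldedValue_le k T L (unroll ω i), abs_shieldedValue_le k T L (unroll (ω * η) i)]

theorem siteChange_eq_localChange {k T L : ℕ} (hn : 2 * k < n) {η : ZMod n → ℤˣ} {i : ZMod n}
    {ω : ZMod n → ℤˣ} (h1 : Shielded k L (unroll ω i)) (h2 : Shielded k L (unroll (ω * η) i)) :
    siteChange k T η i ω = localChange k T L η i ω := by
  unfold siteChange localChange shieldedValue
  rw [if_pos h1, if_pos h2, iterate_cycleStep_eq_unroll hn, iterate_cycleStep_eq_unroll hn]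

theorem expect_localChange [NeZero n] (k T L : ℕ) (η : ZMod n → ℤˣ) (i : ZMod n) :
    𝔼 ω, localChange k T L η i ω = 0 := by
  refine expect_eq_zero_of_odd fun ω => ?_
  have h1 : unroll (-ω) i = -unroll ω i := rfl
  have h2 : unroll (-ω * η) i = -unroll (ω * η) i := by
    rw [neg_mul]; rfl
  unfold localChange
  rw [h1, h2, shieldedValue_neg, shieldedValue_neg]
  ring

theorem localChange_congr {k T L : ℕ} {η : ZMod n → ℤˣ} {i : ZMod n} {ω ω' : ZMod n → ℤˣ}
    (h : ∀ x ∈ (fun s : ℤ => i + (s : ZMod n)) '' Set.Icc (-(L : ℤ)) L, ω x = ω' x) :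
    localChange k T L η i ω = localChange k T L η i ω' := by
  have h' : ∀ s ∈ Finset.Icc (-(L : ℤ)) L, ω (i + s) = ω' (i + s) := fun s hs =>
    h _ ⟨s, by simpa using hs, rfl⟩
  unfold localChange
  congr 1
  · exact shieldedValue_congr h'
  · exact shieldedValue_congr fun s hs => by simp [unroll, h' s hs]

/-- The localized changes depend on disjoint windows and have mean zero, so their product has mean
zero. Passing to the true changes costs at most `4 + 4 = 8` on a union of four events, each of
probability at most `shieldBound k L`. -/
theorem expect_siteChange_mul_le_of_far [NeZero n] {k T L : ℕ} (hn : 2 * k < n) (hL : 2 * L < n)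
    (η : ZMod n → ℤˣ) {i j : ZMod n} (hij : 2 * L < (j - i).valMinAbs.natAbs) :
    𝔼 ω, siteChange k T η i ω * siteChange k T η j ω ≤ 32 * shieldBound k L := by
  classical
  have hdisj : Disjoint ((fun s : ℤ => i + (s : ZMod n)) '' Set.Icc (-(L : ℤ)) L)
      ((fun s : ℤ => j + (s : ZMod n)) '' Set.Icc (-(L : ℤ)) L) := by
    rw [Set.disjoint_left]
    rintro _ ⟨s, hs, rfl⟩ ⟨t, ht, hst⟩
    simp only [Set.mem_Icc] at hs ht
    have h1 : (((j - i).valMinAbs : ℤ) : ZMod n) = ((s - t : ℤ) : ZMod n) := by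
      rw [ZMod.coe_valMinAbs]
      push_cast
      linear_combination hst
    -- `valMinAbs` is the representative of least absolute value, whereas a common point would
    -- produce one of size at most `2L`.
    have := ZMod.natAbs_min_of_le_div_two n _ _ h1 (ZMod.natAbs_valMinAbs_le _)
    omega
  have hzero : 𝔼 ω, localChange k T L η i ω * localChange k T L η j ω = 0 := by
    rw [expect_mul_of_disjoint hdisj (fun ω ω' h => localChange_congr h)
      fun ω ω' h => localChange_congr h, expect_localChange, zero_mul]
  have hpt : ∀ ω : ZMod n → ℤˣ, siteChange k T η i ω * siteChange k T η j ω ≤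
      localChange k T L η i ω * localChange k T L η j ω +
      8 * if ((¬ Shielded k L (unroll ω i) ∨ ¬ Shielded k L (unroll (ω * η) i)) ∨
        (¬ Shielded k L (unroll ω j) ∨ ¬ Shielded k L (unroll (ω * η) j))) then 1 else 0 := by
    intro ω
    split_ifs with h
    · have h1 : |siteChange k T η i ω * siteChange k T η j ω| ≤ 2 * 2 := by
        rw [abs_mul]
        exact mul_le_mul (abs_siteChange_le ..) (abs_siteChange_le ..) (abs_nonneg _) (by norm_num)
      have h2 : |localChange k T L η i ω * localChange k T L η j ω| ≤ 2 * 2 := by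
        rw [abs_mul]
        exact mul_le_mul (abs_localChange_le ..) (abs_localChange_le ..) (abs_nonneg _)
          (by norm_num)
      linarith [(abs_le.1 h1).2, (abs_le.1 h2).1]
    · push Not at h
      rw [siteChange_eq_localChange hn h.1.1 h.1.2, siteChange_eq_localChange hn h.2.1 h.2.2]
      simp
  refine (Finset.expect_le_expect fun ω _ => hpt ω).trans ?_
  rw [Finset.expect_add_distrib, hzero, zero_add, ← Finset.mul_expect]
  have h1 := uniformProb_or_le
    (fun ω : ZMod n → ℤˣ => ¬ Shielded k L (unroll ω i) ∨ ¬ Shielded k L (unroll (ω * η) i))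
    (fun ω : ZMod n → ℤˣ => ¬ Shielded k L (unroll ω j) ∨ ¬ Shielded k L (unroll (ω * η) j))
  have h2 := fun i : ZMod n => uniformProb_or_le
    (fun ω : ZMod n → ℤˣ => ¬ Shielded k L (unroll ω i))
    (fun ω : ZMod n → ℤˣ => ¬ Shielded k L (unroll (ω * η) i))
  have h3 := fun i : ZMod n => uniformProb_not_shielded_unroll_le k hL i
  have h4 := fun i : ZMod n => uniformProb_not_shielded_unroll_mul_le k hL i η
  have h5 : uniformProb (fun ω : ZMod n → ℤˣ =>
      (¬ Shielded k L (unroll ω i) ∨ ¬ Shielded k L (unroll (ω * η) i)) ∨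
        (¬ Shielded k L (unroll ω j) ∨ ¬ Shielded k L (unroll (ω * η) j))) ≤
      4 * shieldBound k L := by
    linarith [h2 i, h2 j, h3 i, h3 j, h4 i, h4 j]
  unfold uniformProb at h5
  refine le_trans (le_of_eq ?_) ((mul_le_mul_of_nonneg_left h5 (by norm_num : (0 : ℝ) ≤ 8)).trans
    (le_of_eq (by ring)))
  congr!

open Classical in
/-- The number of flipped sites within distance `K` of the site `i`. -/
noncomputable def flipsNear (K : ℕ) (η : ZMod n → ℤˣ) (i : ZMod n) : ℝ :=
  ∑ s ∈ Finset.Icc (-(K : ℤ)) K, if η (i + s) = -1 then 1 else 0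

theorem flipsNear_nonneg (K : ℕ) (η : ZMod n → ℤˣ) (i : ZMod n) : 0 ≤ flipsNear K η i :=
  Finset.sum_nonneg fun s _ => by split_ifs <;> norm_num

open Classical in
theorem sum_flipsNear [NeZero n] (K : ℕ) (η : ZMod n → ℤˣ) :
    ∑ i, flipsNear K η i = (2 * K + 1) * ∑ x, if η x = -1 then 1 else 0 := by
  unfold flipsNear
  rw [Finset.sum_comm]
  have : ∀ s ∈ Finset.Icc (-(K : ℤ)) K, (∑ i : ZMod n, if η (i + s) = -1 then (1 : ℝ) else 0) =
      ∑ x, if η x = -1 then 1 else 0 := fun s _ =>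
    Fintype.sum_equiv (Equiv.addRight (s : ZMod n)) _ _ fun _ => rfl
  rw [Finset.sum_congr rfl this, Finset.sum_const, Int.card_Icc, nsmul_eq_mul]
  congr 1
  have : ((K : ℤ) + 1 - -(K : ℤ)).toNat = 2 * K + 1 := by omega
  rw [this]; push_cast; ring

/-- Without a flip within distance `K` of `i`, the change at `i` vanishes whenever `i` is shielded.
With such a flip, `flipsNear` is at least one and the trivial bound 4 is enough. -/
theorem expect_siteChange_mul_le [NeZero n] {k T K : ℕ} (hn : 2 * k < n) (hK : 2 * K < n)
    (η : ZMod n → ℤˣ) (i j : ZMod n) :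
    𝔼 ω, siteChange k T η i ω * siteChange k T η j ω ≤
      4 * (shieldBound k K + flipsNear K η i) := by
  classical
  by_cases hη : ∀ s ∈ Finset.Icc (-(K : ℤ)) K, η (i + s) = 1
  · refine le_trans (b := 4 * uniformProb fun ω : ZMod n → ℤˣ => ¬ Shielded k K (unroll ω i)) ?_ ?_
    · unfold uniformProb
      rw [Finset.mul_expect]
      refine Finset.expect_le_expect fun ω _ => ?_
      split_ifs with h
      · have h1 : |siteChange k T η i ω * siteChange k T η j ω| ≤ 2 * 2 := by
          rw [abs_mul]
          exact mul_le_mul (abs_siteChange_le ..) (abs_siteChange_le ..) (abs_nonneg _)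
            (by norm_num)
        linarith [(abs_le.1 h1).2]
      · have h2 : siteChange k T η i ω = 0 := by
          unfold siteChange
          rw [iterate_cycleStep_eq_unroll hn, iterate_cycleStep_eq_unroll hn,
            (not_not.1 h).iterate_congr (ξ := unroll (ω * η) i) fun s hs => by
              simp [unroll, hη s hs]]
          simp
        simp [h2]
    · have := uniformProb_not_shielded_unroll_le k hK i
      have := flipsNear_nonneg K η i
      linarith
  · push Not at hη
    obtain ⟨s, hs, hsη⟩ := hη
    have hsη' := (Int.units_eq_one_or _).resolve_left hsη
    have h1 : 1 ≤ flipsNear K η i := by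
      refine le_trans ?_ (Finset.single_le_sum (f := fun s : ℤ => if η (i + s) = -1 then (1 : ℝ)
        else 0) (fun t _ => by split_ifs <;> norm_num) hs)
      simp [hsη']
    have h2 : 𝔼 ω, siteChange k T η i ω * siteChange k T η j ω ≤ 4 := by
      refine Finset.expect_le Finset.univ_nonempty fun ω _ => (le_abs_self _).trans ?_
      rw [abs_mul]
      refine (mul_le_mul (abs_siteChange_le ..) (abs_siteChange_le ..) (abs_nonneg _)
        (by norm_num)).trans (by norm_num)
    have := shieldBound_nonneg k K
    linarith

/-- The tail of the sum of the bounds for covariances at distances larger than `K`. -/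
noncomputable def shieldTail (k K : ℕ) : ℝ := ∑' d, shieldBound k ((d + K) / 2)

open Classical in
theorem expect_sq_sum_siteChange_le [NeZero n] {k T K : ℕ} (hn : 2 * k < n) (hK : 2 * K < n)
    (η : ZMod n → ℤˣ) :
    𝔼 ω, (∑ i, siteChange k T η i ω) ^ 2 ≤
      n * (8 * (K + 1) * shieldBound k K + 64 * shieldTail k K) +
        8 * (K + 1) * (2 * K + 1) * ∑ x, if η x = -1 then 1 else 0 := by
  have hexp : 𝔼 ω, (∑ i, siteChange k T η i ω) ^ 2 =
      ∑ i, ∑ u, 𝔼 ω, siteChange k T η i ω * siteChange k T η (i + u) ω := by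
    simp_rw [sq, Finset.sum_mul_sum]
    rw [Finset.expect_sum_comm]
    refine Finset.sum_congr rfl fun i _ => ?_
    rw [Finset.expect_sum_comm]
    exact (Fintype.sum_equiv (Equiv.addLeft i) _ _ fun _ => rfl).symm
  have hrow : ∀ i : ZMod n, ∑ u, 𝔼 ω, siteChange k T η i ω * siteChange k T η (i + u) ω ≤
      8 * (K + 1) * (shieldBound k K + flipsNear K η i) + 64 * shieldTail k K := by
    intro i
    have hb0 := shieldBound_nonneg k K
    have hf0 := flipsNear_nonneg K η i
    set c := 4 * (shieldBound k K + flipsNear K η i) with hc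
    -- Covariance bound at cyclic distance `d`. Beyond `K` the far estimate is used with `L = (d -
    -- 1) / 2`, the largest radius for which `2L < d`.
    let G : ℕ → ℝ := fun d => if d < K + 1 then c else 32 * shieldBound k ((d - 1) / 2)
    have hG : ∀ d, 0 ≤ G d := fun d => by
      simp only [G]
      split_ifs
      · positivity
      · exact mul_nonneg (by norm_num) (shieldBound_nonneg _ _)
    have h1 : ∑ u, 𝔼 ω, siteChange k T η i ω * siteChange k T η (i + u) ω ≤
        ∑ u : ZMod n, G u.valMinAbs.natAbs := by
      refine Finset.sum_le_sum fun u _ => ?_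
      simp only [G]
      split_ifs with hu
      · exact expect_siteChange_mul_le hn hK η i (i + u)
      · have := u.natAbs_valMinAbs_le
        refine expect_siteChange_mul_le_of_far hn (by omega) η ?_
        rw [add_sub_cancel_left]
        omega
    have h2 : ∑ d ∈ Finset.range n, G d ≤ (K + 1) * c + 32 * shieldTail k K := by
      have hsum : Summable fun d => shieldBound k ((d + K) / 2) :=
        (summable_nat_add_iff (f := fun d => shieldBound k (d / 2)) K).2 (summable_shieldBound k)
      have hle : ∑ d ∈ Finset.range n, G d ≤ ∑ d ∈ Finset.range (K + 1 + n), G d :=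
        Finset.sum_le_sum_of_subset_of_nonneg
          (Finset.range_subset_range.2 (by omega)) fun d _ _ => hG d
      refine hle.trans ?_
      rw [Finset.sum_range_add]
      refine add_le_add (le_of_eq ?_) ?_
      · rw [Finset.sum_congr rfl fun d hd => if_pos (Finset.mem_range.1 hd)]
        simp
      · unfold shieldTail
        rw [← tsum_mul_left]
        refine le_trans (le_of_eq ?_) ((hsum.mul_left 32).sum_le_tsum (Finset.range n)
          fun d _ => mul_nonneg (by norm_num) (shieldBound_nonneg _ _))
        refine Finset.sum_congr rfl fun d _ => ?_
        simp only [G]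
        rw [if_neg (by omega)]
        congr 3
        omega
    have h3 := sum_natAbs_valMinAbs_le (n := n) hG
    linarith
  rw [hexp]
  refine (Finset.sum_le_sum fun i _ => hrow i).trans (le_of_eq ?_)
  simp only [mul_add, Finset.sum_add_distrib, ← Finset.mul_sum, sum_flipsNear, Finset.sum_const,
    Finset.card_univ, ZMod.card, nsmul_eq_mul]
  ring

end Cycle

theorem tendsto_second_moment_bound (k : ℕ) :
    Tendsto (fun K : ℕ => 8 * ((K : ℝ) + 1) * shieldBound k K + 64 * shieldTail k K) atTop
      (𝓝 0) := by
  have h1 := (tendsto_mul_shieldBound k).add (tendsto_shield_bound k)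
  have h2 := tendsto_sum_nat_add fun d => shieldBound k (d / 2)
  have h3 := (h1.const_mul 8).add (h2.const_mul 64)
  simp only [add_zero, mul_zero] at h3
  refine h3.congr fun K => ?_
  unfold shieldTail shieldBound
  ring

/-! ### A small ball estimate for sums of random signs -/

theorem centralBinom_sq_mul_le (m : ℕ) : m.centralBinom ^ 2 * (2 * m + 1) ≤ 4 ^ (2 * m) := by
  induction m with
  | zero => simp
  | succ m ih =>
    have h := Nat.succ_mul_centralBinom_succ m
    refine Nat.le_of_mul_le_mul_left (c := (m + 1) ^ 2) ?_ (by positivity)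
    calc (m + 1) ^ 2 * ((m + 1).centralBinom ^ 2 * (2 * (m + 1) + 1))
        = ((m + 1) * (m + 1).centralBinom) ^ 2 * (2 * m + 3) := by ring
      _ = (m.centralBinom ^ 2 * (2 * m + 1)) * (4 * ((2 * m + 1) * (2 * m + 3))) := by
          rw [h]; ring
      -- The induction closes because `(2m+1)(2m+3) ≤ 4(m+1)²`.
      _ ≤ 4 ^ (2 * m) * (4 * (4 * (m + 1) ^ 2)) := by
          refine Nat.mul_le_mul ih (Nat.mul_le_mul_left _ ?_)
          nlinarith
      _ = (m + 1) ^ 2 * 4 ^ (2 * (m + 1)) := by ring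

theorem choose_sq_mul_le (N t : ℕ) : N.choose t ^ 2 * N ≤ 4 ^ N := by
  obtain ⟨m, rfl | rfl⟩ := Nat.even_or_odd' N
  · have h1 := Nat.choose_le_centralBinom t m
    have h2 := centralBinom_sq_mul_le m
    calc (2 * m).choose t ^ 2 * (2 * m) ≤ m.centralBinom ^ 2 * (2 * m + 1) := by gcongr; omega
      _ ≤ _ := h2
  · have h1 : (2 * m + 1).choose t ≤ 2 * m.centralBinom := by
      cases t with
      | zero => have := m.centralBinom_pos; simp; omega
      | succ t =>
        rw [Nat.choose_succ_succ]
        have := Nat.choose_le_centralBinom t m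
        have := Nat.choose_le_centralBinom (t + 1) m
        simp only [Nat.succ_eq_add_one]
        omega
    have h2 := centralBinom_sq_mul_le m
    calc (2 * m + 1).choose t ^ 2 * (2 * m + 1) ≤ (2 * m.centralBinom) ^ 2 * (2 * m + 1) := by
          gcongr
      _ = 4 * (m.centralBinom ^ 2 * (2 * m + 1)) := by ring
      _ ≤ 4 * 4 ^ (2 * m) := by gcongr
      _ = 4 ^ (2 * m + 1) := by ring

theorem choose_le_two_pow_div_sqrt {N : ℕ} (hN : 0 < N) (t : ℕ) :
    (N.choose t : ℝ) ≤ 2 ^ N / √N := by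
  have hN' : (0 : ℝ) < N := by exact_mod_cast hN
  rw [le_div_iff₀ (Real.sqrt_pos.2 hN')]
  refine (pow_le_pow_iff_left₀ (by positivity) (by positivity) two_ne_zero).1 ?_
  rw [mul_pow, Real.sq_sqrt hN'.le, ← pow_mul, mul_comm N 2, pow_mul]
  have := choose_sq_mul_le N t
  norm_num
  exact_mod_cast this

section SmallBall

variable {ι : Type} [Fintype ι] [DecidableEq ι]

theorem card_inter_eq_le (G : Finset ι) (t : ℕ) :
    (Finset.univ.filter fun A : Finset ι => (A ∩ G).card = t).card ≤
      G.card.choose t * 2 ^ (Fintype.card ι - G.card) := by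
  rw [← Finset.card_powersetCard, ← Finset.card_compl, ← Finset.card_powerset,
    ← Finset.card_product]
  refine Finset.card_le_card_of_injOn (fun A => (A ∩ G, A \ G)) ?_ ?_
  · intro A hA
    simp only [Finset.coe_filter, Finset.mem_univ, true_and] at hA
    simp only [Finset.coe_product, Set.mem_prod, Finset.mem_coe, Finset.mem_powersetCard,
      Finset.mem_powerset]
    refine ⟨⟨Finset.inter_subset_right, hA⟩, fun x hx => ?_⟩
    simp only [Finset.mem_sdiff, Finset.mem_compl] at hx ⊢
    exact hx.2
  · intro A _ B _ hAB
    simp only [Prod.mk.injEq] at hAB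
    rw [← Finset.sdiff_union_inter A G, hAB.1, hAB.2, Finset.sdiff_union_inter]

theorem uniformProb_card_inter_eq_le {G : Finset ι} (hG : 0 < G.card) (t : ℕ) :
    uniformProb (fun A : Finset ι => (A ∩ G).card = t) ≤ 1 / √G.card := by
  rw [uniformProb_eq_card_div, Fintype.card_finset, div_le_iff₀ (by positivity)]
  calc ((Finset.univ.filter fun A : Finset ι => (A ∩ G).card = t).card : ℝ)
      ≤ G.card.choose t * 2 ^ (Fintype.card ι - G.card) := by exact_mod_cast card_inter_eq_le G t
    _ ≤ 2 ^ G.card / √G.card * 2 ^ (Fintype.card ι - G.card) := by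
        gcongr; exact choose_le_two_pow_div_sqrt hG t
    _ = 1 / √G.card * (2 ^ (G.card + (Fintype.card ι - G.card))) := by
        rw [pow_add]; ring
    _ = 1 / √G.card * ((2 ^ Fintype.card ι : ℕ) : ℝ) := by
        rw [Nat.add_sub_cancel' (Finset.card_le_univ G)]; push_cast; rfl

theorem uniformProb_exists_mem_le {Ω : Type} [Fintype Ω] {κ : Type} (s : Finset κ)
    (p : κ → Ω → Prop) :
    uniformProb (fun ω => ∃ t ∈ s, p t ω) ≤ ∑ t ∈ s, uniformProb (p t) := by
  classical
  induction s using Finset.induction_on with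
  | empty => simp [uniformProb]
  | insert a s ha ih =>
    rw [Finset.sum_insert ha]
    refine le_trans ?_ ((uniformProb_or_le _ _).trans (add_le_add_right ih _))
    exact uniformProb_mono fun ω h => by simpa using h

/-- The sum of the signs `σ j`, `j ∈ G`, those in the random set `A` being reversed, takes values
in a given short interval with small probability. -/
theorem uniformProb_abs_sum_le {G : Finset ι} (hG : 0 < G.card) (σ : ι → ℤˣ) (C : ℤ) {a : ℕ}
    (ha : 0 < a) (r : ℕ) :
    uniformProb (fun A : Finset ι =>
      |C + a * ∑ j ∈ G, ((σ j : ℤ) * if j ∈ A then -1 else 1)| ≤ r) ≤ (r + 1) / √G.card := by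
  classical
  set B : Finset ι := Finset.univ.filter fun j => σ j = -1 with hB
  -- Symmetric difference with the set of negative signs preserves the uniform law on subsets and
  -- reduces to the case of all signs positive.
  let e : Finset ι ≃ Finset ι := (symmDiff_left_involutive B).toPerm
  have hsum : ∀ A : Finset ι, ∑ j ∈ G, ((σ j : ℤ) * if j ∈ A then -1 else 1) =
      G.card - 2 * (e A ∩ G).card := by
    intro A
    have h1 : ∀ j ∈ G, ((σ j : ℤ) * if j ∈ A then -1 else 1) =
        1 - 2 * if j ∈ e A then 1 else 0 := by
      intro j _
      have hj : j ∈ e A ↔ (j ∈ A ↔ ¬ σ j = -1) := by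
        show j ∈ symmDiff A B ↔ _
        rw [Finset.mem_symmDiff]
        simp only [hB, Finset.mem_filter, Finset.mem_univ, true_and]
        tauto
      rcases Int.units_eq_one_or (σ j) with h | h <;> by_cases hA : j ∈ A <;>
        simp [hj, h, hA]
    rw [Finset.sum_congr rfl h1, Finset.sum_sub_distrib, ← Finset.mul_sum, Finset.sum_boole,
      Finset.sum_const, Finset.filter_mem_eq_inter, Finset.inter_comm]
    simp
  -- The admissible counts: the sum moves in steps of `2a ≥ 2`, so an interval of length `2r`
  -- contains at most `r + 1` of its values.
  set I := (Finset.range (G.card + 1)).filter fun t : ℕ => |C + a * (G.card - 2 * t : ℤ)| ≤ r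
    with hI
  have hIcard : I.card ≤ r + 1 := by
    rcases I.eq_empty_or_nonempty with h | h
    · simp [h]
    · obtain ⟨t₀, ht₀, hmin⟩ := I.exists_min_image id h
      have : I ⊆ Finset.Icc t₀ (t₀ + r) := by
        intro t ht
        have h0 := hmin t ht
        simp only [hI, Finset.mem_filter, abs_le] at ht ht₀
        simp only [id_eq] at h0
        rw [Finset.mem_Icc]
        refine ⟨h0, ?_⟩
        have h1 : (a : ℤ) * (t - t₀) ≤ r := by linarith [ht.2.1, ht₀.2.2]
        have h2 : (0 : ℤ) ≤ t - t₀ := by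
          have : (t₀ : ℤ) ≤ t := by exact_mod_cast h0
          linarith
        have h3 : (1 : ℤ) ≤ a := by exact_mod_cast ha
        have h4 : (t : ℤ) ≤ t₀ + r := by nlinarith
        exact_mod_cast h4
      refine (Finset.card_le_card this).trans ?_
      rw [Nat.card_Icc]; omega
  calc uniformProb (fun A : Finset ι =>
        |C + a * ∑ j ∈ G, ((σ j : ℤ) * if j ∈ A then -1 else 1)| ≤ r)
      = uniformProb (fun A : Finset ι => |C + a * (G.card - 2 * (e A ∩ G).card : ℤ)| ≤ r) := by
        simp only [hsum]
    _ = uniformProb (fun A : Finset ι => |C + a * (G.card - 2 * (A ∩ G).card : ℤ)| ≤ r) :=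
        uniformProb_equiv e fun A : Finset ι => |C + a * (G.card - 2 * (A ∩ G).card : ℤ)| ≤ r
    _ ≤ uniformProb (fun A : Finset ι => ∃ t ∈ I, (A ∩ G).card = t) :=
        uniformProb_mono fun A hA => ⟨_, by
          rw [hI, Finset.mem_filter, Finset.mem_range]
          exact ⟨Nat.lt_succ_of_le (Finset.card_le_card Finset.inter_subset_right), hA⟩, rfl⟩
    _ ≤ ∑ t ∈ I, uniformProb (fun A : Finset ι => (A ∩ G).card = t) :=
        uniformProb_exists_mem_le _ _
    _ ≤ ∑ t ∈ I, 1 / √G.card := Finset.sum_le_sum fun t _ => uniformProb_card_inter_eq_le hG t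
    _ = I.card * (1 / √G.card) := by rw [Finset.sum_const, nsmul_eq_mul]
    _ ≤ (r + 1 : ℕ) * (1 / √G.card) := by gcongr
    _ = (r + 1) / √G.card := by push_cast; ring

end SmallBall

/-! ### Cells of three blocks on the cycle -/

section Cells

variable {n : ℕ}

/-- The index of the block of `k+1` consecutive sites which contains `x`. -/
def blockIndex (k : ℕ) (x : ZMod n) : ℕ := x.val / (k + 1)

/-- All three blocks of the cell `j`, consisting of the blocks `3j`, `3j+1`, `3j+2`, are
constant. -/
def GoodCell (k : ℕ) (ω : ZMod n → ℤˣ) (j : ℕ) : Prop :=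
  ∀ x y : ZMod n, blockIndex k x = blockIndex k y → blockIndex k x / 3 = j → ω x = ω y

/-- The site `x` is in the middle block of a good cell with index in `A`. -/
def InMiddle (k : ℕ) {m : ℕ} (A : Finset (Fin m)) (ω : ZMod n → ℤˣ) (x : ZMod n) : Prop :=
  blockIndex k x % 3 = 1 ∧ ∃ j ∈ A, blockIndex k x / 3 = j ∧ GoodCell k ω j

open Classical in
/-- Reverse the middle blocks of the good cells with index in `A`. -/
noncomputable def flipMiddle (k : ℕ) {m : ℕ} (A : Finset (Fin m)) (ω : ZMod n → ℤˣ) :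
    ZMod n → ℤˣ := fun x => if InMiddle k A ω x then -ω x else ω x

theorem GoodCell.congr {k j : ℕ} {ω ω' : ZMod n → ℤˣ} (h : GoodCell k ω j)
    (hω : ∀ x, blockIndex k x / 3 = j → ω x = ω' x) : GoodCell k ω' j := fun x y hxy hx => by
  rw [← hω x hx, ← hω y (hxy ▸ hx), h x y hxy hx]

theorem goodCell_flipMiddle_of {k m j : ℕ} {A : Finset (Fin m)} {ω : ZMod n → ℤˣ}
    (h : GoodCell k ω j) : GoodCell k (flipMiddle k A ω) j := fun x y hxy hx => by
  unfold flipMiddle InMiddle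
  rw [hxy, h x y hxy hx]

/-- Blocks are reversed as a whole, so good cells stay good; a bad cell is not touched at all. Hence
a second reversal acts on the same sites, which makes `flipMiddle` an involution. -/
theorem goodCell_flipMiddle {k m j : ℕ} {A : Finset (Fin m)} {ω : ZMod n → ℤˣ} :
    GoodCell k (flipMiddle k A ω) j ↔ GoodCell k ω j := by
  refine ⟨fun h => ?_, goodCell_flipMiddle_of⟩
  by_contra hω
  refine hω (h.congr fun x hx => ?_)
  unfold flipMiddle
  rw [if_neg]
  rintro ⟨-, i, -, hi, hg⟩
  exact hω (by rwa [← hx, hi])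

theorem inMiddle_flipMiddle {k m : ℕ} {A B : Finset (Fin m)} {ω : ZMod n → ℤˣ} {x : ZMod n} :
    InMiddle k A (flipMiddle k B ω) x ↔ InMiddle k A ω x := by
  unfold InMiddle
  simp only [goodCell_flipMiddle]

theorem flipMiddle_involutive (k : ℕ) {m : ℕ} (A : Finset (Fin m)) :
    Function.Involutive (flipMiddle (n := n) k A) := by
  intro ω
  funext x
  by_cases h : InMiddle k A ω x
  · rw [flipMiddle, if_pos (inMiddle_flipMiddle.2 h), flipMiddle, if_pos h, neg_neg]
  · rw [flipMiddle, if_neg (mt inMiddle_flipMiddle.1 h), flipMiddle, if_neg h]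

theorem intCast_eq_add (n : ℕ) (x y : ℤ) : (y : ZMod n) = (x : ZMod n) + ((y - x : ℤ) : ZMod n) := by
  push_cast; ring

theorem iterate_cycleStep_intCast {k : ℕ} (hn : 2 * k < n) (T : ℕ) (ω : ZMod n → ℤˣ) (x : ℤ) :
    (cycleStep k n)^[T] ω x = (lineStep k)^[T] (fun s : ℤ => ω s) x := by
  have := iterate_cycleStep_apply hn T ω 0 x
  simpa only [zero_add] using this

theorem mem_block_self (k : ℕ) (x : ℤ) :
    x ∈ Finset.Icc (x - (((x : ZMod n).val % (k + 1) : ℕ) : ℤ))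
      (x - (((x : ZMod n).val % (k + 1) : ℕ) : ℤ) + k) := by
  have := Nat.mod_lt (x : ZMod n).val (show 0 < k + 1 by omega)
  rw [Finset.mem_Icc]
  omega

/-! ### Evolution after reversing middle blocks. -/

section Evolution

variable [NeZero n] {k m : ℕ}

theorem val_add_intCast (z : ZMod n) {s : ℤ} {w : ℕ} (hw : (z.val : ℤ) + s = w) (hwn : w < n) :
    (z + (s : ZMod n)).val = w := by
  have : z + (s : ZMod n) = (w : ZMod n) := by
    have h1 : ((z.val : ℤ) : ZMod n) = z := by simp
    rw [← h1, ← Int.cast_add, hw, Int.cast_natCast]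
  rw [this, ZMod.val_cast_of_lt hwn]

theorem blockIndex_of_mem_block (hm : m * 3 * (k + 1) ≤ n) {x : ℤ}
    (hx : blockIndex k (x : ZMod n) / 3 < m) {y : ℤ}
    (hy : y ∈ Finset.Icc (x - (((x : ZMod n).val % (k + 1) : ℕ) : ℤ))
      (x - (((x : ZMod n).val % (k + 1) : ℕ) : ℤ) + k)) :
    blockIndex k (y : ZMod n) = blockIndex k (x : ZMod n) := by
  unfold blockIndex at *
  set v := (x : ZMod n).val with hv
  have h1 := Nat.div_add_mod v (k + 1)
  have h2 := Nat.mod_lt v (Nat.succ_pos k)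
  set b := v / (k + 1)
  set r := v % (k + 1)
  rw [Finset.mem_Icc] at hy
  have hb : (b + 1) * (k + 1) ≤ n := le_trans (Nat.mul_le_mul_right _ (by omega)) hm
  obtain ⟨q, hq⟩ : ∃ q : ℕ, (y - (x - (r : ℤ))) = q := Int.eq_ofNat_of_zero_le (by omega)
  have hqk : q ≤ k := by omega
  have h3 : (k + 1) * b + q < n := by nlinarith
  rw [intCast_eq_add n x y, val_add_intCast (x : ZMod n) (s := y - x) (w := (k + 1) * b + q)
    (by rw [← hv]; push_cast; have : (v : ℤ) = (k + 1) * b + r := by exact_mod_cast h1.symm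
        linarith) h3]
  rw [Nat.mul_add_div (Nat.succ_pos k), Nat.div_eq_of_lt (by omega), add_zero]

theorem constBlock_of_goodCell (hm : m * 3 * (k + 1) ≤ n) {ω : ZMod n → ℤˣ} {x : ℤ}
    (hx : blockIndex k (x : ZMod n) / 3 < m)
    (hg : GoodCell k ω (blockIndex k (x : ZMod n) / 3)) :
    ConstBlock k (fun s : ℤ => ω s) (x - (((x : ZMod n).val % (k + 1) : ℕ) : ℤ)) := by
  intro y hy
  have h1 := blockIndex_of_mem_block hm hx hy
  have h2 := blockIndex_of_mem_block hm hx
    (y := x - (((x : ZMod n).val % (k + 1) : ℕ) : ℤ)) (by simp)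
  exact hg _ _ (h1.trans h2.symm) (by rw [h1])

/-- The outer blocks have width `k+1`, more than the distance `k`, and `hm` prevents the cell from
wrapping around. -/
theorem cell_eq_of_near_middle (hm : m * 3 * (k + 1) ≤ n) {x y : ℤ}
    (hy : blockIndex k (y : ZMod n) / 3 < m) (hmid : blockIndex k (y : ZMod n) % 3 = 1)
    (hxy : x ∈ Finset.Icc (y - k) (y + k)) :
    blockIndex k (x : ZMod n) / 3 = blockIndex k (y : ZMod n) / 3 := by
  unfold blockIndex at *
  set v := (y : ZMod n).val with hv
  have h1 := Nat.div_add_mod v (k + 1)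
  have h2 := Nat.mod_lt v (Nat.succ_pos k)
  set b := v / (k + 1) with hb
  set r := v % (k + 1)
  rw [Finset.mem_Icc] at hxy
  obtain ⟨c, hc⟩ : ∃ c, b = 3 * c + 1 := ⟨b / 3, by omega⟩
  have hbn : (3 * c + 3) * (k + 1) ≤ n := le_trans (Nat.mul_le_mul_right _ (by omega)) hm
  have h1' : (v : ℤ) = (k + 1) * (3 * c + 1) + r := by
    rw [hc] at h1
    exact_mod_cast h1.symm
  obtain ⟨q, hq⟩ : ∃ q : ℕ, (x - y + (k + 1) + r) = q := Int.eq_ofNat_of_zero_le (by omega)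
  have hqk : q < 3 * (k + 1) := by omega
  have h3 : (k + 1) * 3 * c + q < n := by nlinarith
  rw [intCast_eq_add n y x, val_add_intCast (y : ZMod n) (s := x - y) (w := (k + 1) * 3 * c + q)
    (by rw [← hv]; push_cast; linarith) h3]
  rw [Nat.div_div_eq_div_mul, Nat.mul_add_div (by positivity), Nat.div_eq_of_lt (by omega)]
  omega

theorem iterate_cycleStep_of_inMiddle (hn : 2 * k < n) (hm : m * 3 * (k + 1) ≤ n)
    {A : Finset (Fin m)} {ω : ZMod n → ℤˣ} {z : ZMod n} (hz : InMiddle k A ω z) (T : ℕ) :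
    (cycleStep k n)^[T] ω z = ω z := by
  obtain ⟨x, rfl⟩ := ZMod.intCast_surjective z
  obtain ⟨-, j, -, hj, hg⟩ := hz
  have hx : blockIndex k (x : ZMod n) / 3 < m := by rw [hj]; exact j.2
  have hc := constBlock_of_goodCell hm hx (by rwa [hj])
  rw [iterate_cycleStep_intCast hn, iterate_lineStep_eq_of_constBlock hc T x (mem_block_self k x)]
  exact (hc x (mem_block_self k x)).symm

theorem iterate_cycleStep_flipMiddle (hn : 2 * k < n) (hm : m * 3 * (k + 1) ≤ n)
    {A : Finset (Fin m)} {ω : ZMod n → ℤˣ} {z : ZMod n} (hz : ¬ InMiddle k A ω z) (T : ℕ) :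
    (cycleStep k n)^[T] (flipMiddle k A ω) z = (cycleStep k n)^[T] ω z := by
  obtain ⟨x, rfl⟩ := ZMod.intCast_surjective z
  rw [iterate_cycleStep_intCast hn, iterate_cycleStep_intCast hn]
  refine (iterate_lineStep_congr (V := {x : ℤ | ¬ InMiddle k A ω (x : ZMod n)}) (fun y hy => ?_)
    (fun y hy => ?_) T x hz).symm
  · exact (if_neg hy).symm
  · have hy' : ¬ InMiddle k A ω (y : ZMod n) := hy
    -- In a good cell with index in `A`, the site belongs to a constant outer block that is left
    -- unreversed. Any other site is too far from the reversed blocks to see one.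
    by_cases hcell : ∃ j ∈ A, blockIndex k (y : ZMod n) / 3 = (j : Fin m) ∧ GoodCell k ω j
    · obtain ⟨j, hjA, hj, hg⟩ := hcell
      have hlt : blockIndex k (y : ZMod n) / 3 < m := by rw [hj]; exact j.2
      refine Or.inl ⟨_, mem_block_self k y, constBlock_of_goodCell hm hlt (by rwa [hj]),
        fun w hw => ?_⟩
      have hb := blockIndex_of_mem_block hm hlt hw
      show ¬ InMiddle k A ω (w : ZMod n)
      unfold InMiddle at hy' ⊢
      rwa [hb]
    · refine Or.inr fun w hw => ?_
      rintro ⟨hmid, j, hjA, hj, hg⟩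
      refine hcell ⟨j, hjA, ?_, hg⟩
      rw [← hj]
      refine cell_eq_of_near_middle hm (by rw [hj]; exact j.2) hmid ?_
      rw [Finset.mem_Icc] at hw ⊢
      omega

theorem card_blockIndex_eq {b : ℕ} (hb : (b + 1) * (k + 1) ≤ n) :
    (Finset.univ.filter fun x : ZMod n => blockIndex k x = b).card = k + 1 := by
  have h : (Finset.Ico (b * (k + 1)) ((b + 1) * (k + 1))).card = k + 1 := by
    rw [Nat.card_Ico, add_mul, one_mul, Nat.add_sub_cancel_left]
  rw [← h]
  refine Finset.card_nbij' (fun x => x.val) (fun v => (v : ZMod n)) ?_ ?_ ?_ ?_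
  · intro x hx
    rw [Finset.mem_coe, Finset.mem_filter] at hx
    have hx := hx.2
    rw [blockIndex, Nat.div_eq_iff (show 0 < k + 1 by omega)] at hx
    simp only [Finset.coe_Ico, Set.mem_Ico]
    rw [add_mul]
    omega
  · intro v hv
    simp only [Finset.coe_Ico, Set.mem_Ico] at hv
    rw [Finset.mem_coe, Finset.mem_filter]
    refine ⟨Finset.mem_univ _, ?_⟩
    rw [blockIndex, ZMod.val_cast_of_lt (by omega), Nat.div_eq_iff (show 0 < k + 1 by omega)]
    rw [add_mul] at hv
    omega
  · intro x _
    simp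
  · intro v hv
    simp only [Finset.coe_Ico, Set.mem_Ico] at hv
    exact ZMod.val_cast_of_lt (by omega)

/-- The sum of the values at time `T`. -/
noncomputable def totalSum (k T : ℕ) (ω : ZMod n → ℤˣ) : ℤ :=
  ∑ i, (((cycleStep k n)^[T] ω i : ℤˣ) : ℤ)

open Classical in
/-- The set of good cells. -/
noncomputable def goodCells (k m : ℕ) (ω : ZMod n → ℤˣ) : Finset (Fin m) :=
  Finset.univ.filter fun j => GoodCell k ω j

/-- `C` collects the sites outside all good middle blocks, whose evolution does not depend on `A`.
Each good middle block is frozen and contributes `k+1` times its sign, reversed when its index is in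
`A`. -/
theorem totalSum_flipMiddle (hn : 2 * k < n) (hm : m * 3 * (k + 1) ≤ n) (T : ℕ)
    (ω : ZMod n → ℤˣ) : ∃ (C : ℤ) (σ : Fin m → ℤˣ), ∀ A : Finset (Fin m),
      totalSum k T (flipMiddle k A ω) =
        C + (k + 1 : ℕ) * ∑ j ∈ goodCells k m ω, ((σ j : ℤ) * if j ∈ A then -1 else 1) := by
  classical
  let σ : Fin m → ℤˣ := fun j => ω (((3 * j + 1) * (k + 1) : ℕ) : ZMod n)
  have hblock : ∀ j : Fin m, (3 * (j : ℕ) + 1 + 1) * (k + 1) ≤ n := fun j =>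
    le_trans (Nat.mul_le_mul_right _ (by have := j.2; omega)) hm
  have hσ : ∀ (j : Fin m) (x : ZMod n), GoodCell k ω j → blockIndex k x = 3 * j + 1 →
      ω x = σ j := fun j x hg hx => by
    have h1 : blockIndex k (((3 * (j : ℕ) + 1) * (k + 1) : ℕ) : ZMod n) = 3 * j + 1 := by
      unfold blockIndex
      rw [ZMod.val_cast_of_lt, Nat.mul_div_cancel _ (Nat.succ_pos k)]
      have := hblock j
      rw [add_mul _ 1, one_mul] at this
      omega
    exact hg _ _ (hx.trans h1.symm) (by omega)
  refine ⟨∑ x, if InMiddle k (Finset.univ : Finset (Fin m)) ω x then 0 else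
    (((cycleStep k n)^[T] ω x : ℤˣ) : ℤ), σ, fun A => ?_⟩
  have hpt : ∀ x : ZMod n, (((cycleStep k n)^[T] (flipMiddle k A ω) x : ℤˣ) : ℤ) =
      (if InMiddle k (Finset.univ : Finset (Fin m)) ω x then 0 else
        (((cycleStep k n)^[T] ω x : ℤˣ) : ℤ)) +
      ∑ j ∈ goodCells k m ω, if blockIndex k x = 3 * (j : ℕ) + 1 then
        ((σ j : ℤ) * if j ∈ A then -1 else 1) else 0 := by
    intro x
    by_cases hx : InMiddle k (Finset.univ : Finset (Fin m)) ω x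
    · obtain ⟨hmid, j, -, hj, hg⟩ := id hx
      have hxj : blockIndex k x = 3 * (j : ℕ) + 1 := by omega
      rw [if_pos hx, zero_add, Finset.sum_eq_single j, if_pos hxj, ← hσ j x hg hxj]
      · by_cases hA : j ∈ A
        · have hxA : InMiddle k A ω x := ⟨hmid, j, hA, hj, hg⟩
          rw [iterate_cycleStep_of_inMiddle hn hm (inMiddle_flipMiddle.2 hxA), flipMiddle,
            if_pos hxA, if_pos hA]
          simp
        · have hxA : ¬ InMiddle k A ω x := by
            rintro ⟨-, i, hi, hij, -⟩
            have : i = j := Fin.ext (hij.symm.trans hj)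
            exact hA (this ▸ hi)
          rw [iterate_cycleStep_flipMiddle hn hm hxA, iterate_cycleStep_of_inMiddle hn hm hx,
            if_neg hA, mul_one]
      · intro i _ hij
        rw [if_neg]
        intro hi
        exact hij (Fin.ext (by omega))
      · intro h
        exact absurd (Finset.mem_filter.2 ⟨Finset.mem_univ j, hg⟩) h
    · have hxA : ¬ InMiddle k A ω x := fun ⟨h1, j, _, h2⟩ => hx ⟨h1, j, Finset.mem_univ j, h2⟩
      rw [if_neg hx, iterate_cycleStep_flipMiddle hn hm hxA, Finset.sum_eq_zero, add_zero]
      intro j hj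
      rw [if_neg]
      intro h
      exact hx ⟨by omega, j, Finset.mem_univ j, by omega, (Finset.mem_filter.1 hj).2⟩
  unfold totalSum
  rw [Finset.sum_congr rfl fun x _ => hpt x, Finset.sum_add_distrib, Finset.sum_comm,
    Finset.mul_sum]
  congr 1
  refine Finset.sum_congr rfl fun j _ => ?_
  rw [← Finset.sum_filter, Finset.sum_const, card_blockIndex_eq (hblock j), nsmul_eq_mul]

end Evolution

/-! ### Anti-concentration of the total sum -/

section AntiConcentration

variable [NeZero n] {k m : ℕ}

theorem card_cell_le (k j : ℕ) :
    (Finset.univ.filter fun x : ZMod n => blockIndex k x / 3 = j).card ≤ 3 * (k + 1) := by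
  have h : (Finset.Ico (j * (3 * (k + 1))) ((j + 1) * (3 * (k + 1)))).card = 3 * (k + 1) := by
    rw [Nat.card_Ico, add_mul, one_mul, Nat.add_sub_cancel_left]
  rw [← h]
  refine Finset.card_le_card_of_injOn (fun x => x.val) ?_ (ZMod.val_injective n).injOn
  intro x hx
  rw [Finset.mem_coe, Finset.mem_filter] at hx
  have hx := hx.2
  rw [blockIndex, Nat.div_div_eq_div_mul, Nat.div_eq_iff (by positivity)] at hx
  simp only [Finset.coe_Ico, Set.mem_Ico]
  rw [add_mul]
  rw [mul_comm (k + 1) 3] at hx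
  omega

theorem le_uniformProb_goodCell (k j : ℕ) :
    (1 / 2 : ℝ) ^ (3 * (k + 1)) ≤ uniformProb fun ω : ZMod n → ℤˣ => GoodCell k ω j := by
  calc (1 / 2 : ℝ) ^ (3 * (k + 1)) ≤
        (1 / 2) ^ (Finset.univ.filter fun x : ZMod n => blockIndex k x / 3 = j).card :=
        pow_le_pow_of_le_one (by norm_num) (by norm_num) (card_cell_le k j)
    _ = _ := (uniformProb_eq_one_on _).symm
    _ ≤ _ := uniformProb_mono fun ω h x y hxy hx => by
        rw [h x (by simpa using hx), h y (by simpa [← hxy] using hx)]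

/-- Chebyshev: distinct cells are independent, so the variance is at most `m`, while the mean is at
least `pm` with `p = (1/2)^(3(k+1))`; the deviation is `pm/2`. -/
theorem uniformProb_few_goodCells_le (hm : 0 < m) :
    uniformProb (fun ω : ZMod n → ℤˣ =>
      ((goodCells k m ω).card : ℝ) ≤ (1 / 2) ^ (3 * (k + 1)) * m / 2) ≤
      4 / (((1 / 2) ^ (3 * (k + 1))) ^ 2 * m) := by
  classical
  have hm' : (0 : ℝ) < m := by exact_mod_cast hm
  set p : ℝ := (1 / 2) ^ (3 * (k + 1)) with hp
  have hp0 : 0 < p := by positivity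
  let P : Fin m → ℝ := fun j => uniformProb fun ω : ZMod n → ℤˣ => GoodCell k ω j
  let Y : Fin m → (ZMod n → ℤˣ) → ℝ := fun j ω => (if GoodCell k ω j then 1 else 0) - P j
  have hP0 : ∀ j, 0 ≤ P j := fun j => uniformProb_nonneg _
  have hP1 : ∀ j, P j ≤ 1 := fun j => uniformProb_le_one _
  have hY1 : ∀ j ω, |Y j ω| ≤ 1 := fun j ω => by
    have := hP0 j
    have := hP1 j
    simp only [Y]
    rw [abs_le]
    split_ifs <;> constructor <;> linarith
  have hY0 : ∀ j, 𝔼 ω, Y j ω = 0 := fun j => by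
    simp only [Y, P]
    rw [Finset.expect_sub_distrib, Fintype.expect_const, uniformProb, sub_eq_zero]
  have hYloc : ∀ (j : Fin m) ω ω', (∀ x ∈ {x : ZMod n | blockIndex k x / 3 = j}, ω x = ω' x) →
      Y j ω = Y j ω' := fun j ω ω' h => by
    have : GoodCell k ω j ↔ GoodCell k ω' j :=
      ⟨fun hg => hg.congr h, fun hg => hg.congr fun x hx => (h x hx).symm⟩
    simp only [Y, this]
  have hcov : ∀ i j, i ≠ j → 𝔼 ω, Y i ω * Y j ω = 0 := fun i j hij => by
    rw [expect_mul_of_disjoint (s := {x : ZMod n | blockIndex k x / 3 = i})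
      (t := {x : ZMod n | blockIndex k x / 3 = j}) ?_ (hYloc i) (hYloc j), hY0, zero_mul]
    rw [Set.disjoint_left]
    intro x hx hx'
    exact hij (Fin.ext (Eq.trans (Eq.symm hx) hx'))
  have hvar : 𝔼 ω, (∑ j, Y j ω) ^ 2 ≤ m := by
    simp_rw [sq, Finset.sum_mul_sum]
    rw [Finset.expect_sum_comm]
    calc ∑ i, 𝔼 ω, ∑ j, Y i ω * Y j ω ≤ ∑ i : Fin m, (1 : ℝ) := by
          refine Finset.sum_le_sum fun i _ => ?_
          rw [Finset.expect_sum_comm, Finset.sum_eq_single i (fun j _ hij => hcov i j hij.symm)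
            (by simp)]
          refine Finset.expect_le Finset.univ_nonempty fun ω _ => (le_abs_self _).trans ?_
          rw [abs_mul]
          exact mul_le_one₀ (hY1 i ω) (abs_nonneg _) (hY1 i ω)
      _ = m := by simp
  have hsumY : ∀ ω, ∑ j, Y j ω = (goodCells k m ω).card - ∑ j, P j := fun ω => by
    simp only [Y, Finset.sum_sub_distrib, Finset.sum_boole, goodCells]
  have hsumP : p * m ≤ ∑ j, P j := by
    calc p * m = ∑ _j : Fin m, p := by simp [mul_comm]
      _ ≤ _ := Finset.sum_le_sum fun j _ => le_uniformProb_goodCell k j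
  have hr : 0 < p * m / 2 := by positivity
  calc uniformProb (fun ω : ZMod n → ℤˣ => ((goodCells k m ω).card : ℝ) ≤ p * m / 2)
      ≤ uniformProb (fun ω : ZMod n → ℤˣ => p * m / 2 ≤ |∑ j, Y j ω|) :=
        uniformProb_mono fun ω h => by
          rw [hsumY, le_abs]
          exact Or.inr (by linarith)
    _ ≤ (𝔼 ω, (∑ j, Y j ω) ^ 2) / (p * m / 2) ^ 2 := uniformProb_le_expect_sq_div _ hr
    _ ≤ m / (p * m / 2) ^ 2 := by gcongr
    _ = 4 / (p ^ 2 * m) := by field_simp; norm_num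

/-- Each `e A` preserves the uniform law, so an auxiliary uniform `A` may be introduced and `ω` then
held fixed. -/
theorem uniformProb_comm {Ω Ω' : Type} [Fintype Ω] [Fintype Ω'] [Nonempty Ω'] {p : Ω → Prop}
    (e : Ω' → Ω ≃ Ω) :
    uniformProb p = 𝔼 ω, uniformProb (fun A : Ω' => p (e A ω)) := by
  have h : ∀ A, uniformProb (fun ω => p (e A ω)) = uniformProb p := fun A =>
    uniformProb_equiv (e A) p
  rw [← Fintype.expect_const (ι := Ω') (uniformProb p), ← Finset.expect_congr rfl fun A _ => h A]
  unfold uniformProb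
  rw [Finset.expect_comm]

/-- The total sum is unlikely to be small. -/
theorem uniformProb_abs_totalSum_le (hn : 2 * k < n) (hm : m * 3 * (k + 1) ≤ n) (hm0 : 0 < m)
    (T r : ℕ) :
    uniformProb (fun ω : ZMod n → ℤˣ => |totalSum k T ω| ≤ r) ≤
      4 / (((1 / 2) ^ (3 * (k + 1))) ^ 2 * m) +
        (r + 1) / √((1 / 2) ^ (3 * (k + 1)) * m / 2) := by
  classical
  have hm' : (0 : ℝ) < m := by exact_mod_cast hm0
  set p : ℝ := (1 / 2) ^ (3 * (k + 1)) with hp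
  have hp0 : 0 < p := by positivity
  have hs : 0 < √(p * m / 2) := Real.sqrt_pos.2 (by positivity)
  rw [uniformProb_comm fun A : Finset (Fin m) => (flipMiddle_involutive k A).toPerm]
  have hpt : ∀ ω : ZMod n → ℤˣ,
      uniformProb (fun A : Finset (Fin m) => |totalSum k T (flipMiddle k A ω)| ≤ r) ≤
      (if ((goodCells k m ω).card : ℝ) ≤ p * m / 2 then 1 else 0) + (r + 1) / √(p * m / 2) := by
    intro ω
    split_ifs with h
    · have := uniformProb_le_one fun A : Finset (Fin m) => |totalSum k T (flipMiddle k A ω)| ≤ r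
      have : 0 ≤ (r + 1) / √(p * m / 2) := by positivity
      linarith
    · rw [not_le] at h
      obtain ⟨C, σ, hC⟩ := totalSum_flipMiddle hn hm T ω
      have hpos : 0 < (goodCells k m ω).card := by
        have : (0 : ℝ) < (goodCells k m ω).card := lt_trans (by positivity) h
        exact_mod_cast this
      simp only [hC]
      refine (uniformProb_abs_sum_le hpos σ C (Nat.succ_pos k) r).trans ?_
      rw [zero_add]
      gcongr
  refine (Finset.expect_le_expect fun ω _ => hpt ω).trans ?_
  rw [Finset.expect_add_distrib, Fintype.expect_const]
  refine add_le_add_left ?_ _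
  refine le_trans (le_of_eq ?_) (uniformProb_few_goodCells_le (n := n) (k := k) hm0)
  unfold uniformProb
  congr!

end AntiConcentration

end Cells

/-! ### Noise stability on the cycle -/

theorem abs_le_abs_sub_of_sign_ne {S S' : ℤ}
    (h : (if 0 < S then (1 : ℤˣ) else -1) ≠ if 0 < S' then 1 else -1) : |S| ≤ |S - S'| := by
  by_cases h1 : 0 < S <;> by_cases h2 : 0 < S'
  · simp [h1, h2] at h
  · rw [abs_of_pos h1, abs_of_pos (by omega)]; omega
  · rw [abs_of_nonpos (by omega), abs_of_nonpos (by omega)]; omega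
  · simp [h1, h2] at h

theorem sum_siteChange {n : ℕ} [NeZero n] (k T : ℕ) (η ω : ZMod n → ℤˣ) :
    ∑ i, siteChange k T η i ω = ((totalSum k T ω - totalSum k T (ω * η) : ℤ) : ℝ) := by
  simp [siteChange, totalSum, Finset.sum_sub_distrib]

/-- A change of sign forces either `|S| ≤ R` or a change of the sum by at least `R`; the floor is
harmless because `S` is an integer. -/
theorem uniformProb_cycleMajority_ne_le {n : ℕ} [NeZero n] (k T : ℕ) (η : ZMod n → ℤˣ) {R : ℝ}
    (hR : 0 < R) :
    uniformProb (fun ω => cycleMajority k T n ω ≠ cycleMajority k T n (ω * η)) ≤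
      uniformProb (fun ω : ZMod n → ℤˣ => |totalSum k T ω| ≤ (⌊R⌋₊ : ℤ)) +
        (𝔼 ω, (∑ i, siteChange k T η i ω) ^ 2) / R ^ 2 := by
  refine le_trans ?_ (add_le_add_right (uniformProb_le_expect_sq_div _ hR) _)
  refine le_trans (uniformProb_mono fun ω h => ?_) (uniformProb_or_le _ _)
  have h1 : |totalSum k T ω| ≤ |totalSum k T ω - totalSum k T (ω * η)| :=
    abs_le_abs_sub_of_sign_ne h
  by_cases h2 : R ≤ |∑ i, siteChange k T η i ω|
  · exact Or.inr h2
  · left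
    rw [not_le, sum_siteChange] at h2
    have h3 : ((|totalSum k T ω| : ℤ) : ℝ) ≤ R := by
      refine le_trans ?_ h2.le
      exact_mod_cast h1
    obtain ⟨s, hs⟩ := Int.eq_ofNat_of_zero_le (abs_nonneg (totalSum k T ω))
    rw [hs] at h3 ⊢
    exact_mod_cast Nat.le_floor (by exact_mod_cast h3)

/-- Anti-concentration of the total sum at the scale of the square root of the length. -/
theorem exists_uniformProb_abs_totalSum_le (k : ℕ) : ∃ c b : ℝ, 0 < c ∧ 0 < b ∧
    ∀ (n : ℕ) [NeZero n], 3 * (k + 1) ≤ n → ∀ (T : ℕ) (δ : ℝ), 0 < δ →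
      uniformProb (fun ω : ZMod n → ℤˣ => |totalSum k T ω| ≤ (⌊δ * √n⌋₊ : ℤ)) ≤
        b / n + c * δ + c / √n := by
  set p : ℝ := (1 / 2) ^ (3 * (k + 1)) with hp
  have hp0 : 0 < p := by positivity
  -- The number `m` of cells is the rounded quotient of `n` by `3(k+1)`; as it is at least one,
  -- rounding loses at most a factor 2.
  set M : ℝ := 6 * (k + 1) with hM
  have hM0 : 0 < M := by positivity
  refine ⟨√(2 * M / p), 4 * M / p ^ 2, Real.sqrt_pos.2 (by positivity), by positivity, ?_⟩
  intro n _ hn T δ hδ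
  set m := n / (3 * (k + 1)) with hm
  have hm1 : m * 3 * (k + 1) ≤ n := by
    rw [mul_assoc]; exact Nat.div_mul_le_self _ _
  have hm0 : 0 < m := Nat.div_pos hn (by positivity)
  have hm0' : (0 : ℝ) < m := by exact_mod_cast hm0
  have hn0 : (0 : ℝ) < n := by
    have : 0 < n := by omega
    exact_mod_cast this
  have hmn : (n : ℝ) / M ≤ m := by
    rw [div_le_iff₀ hM0]
    have h1 := Nat.lt_mul_div_succ n (show 0 < 3 * (k + 1) by positivity)
    have h2 : n ≤ m * (6 * (k + 1)) := by nlinarith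
    rw [hM]
    exact_mod_cast h2
  have hmain := uniformProb_abs_totalSum_le (by omega) hm1 hm0 T ⌊δ * √n⌋₊
  rw [← hp] at hmain
  refine hmain.trans ?_
  have hfl : (⌊δ * √n⌋₊ : ℝ) ≤ δ * √n := Nat.floor_le (by positivity)
  have hsn : 0 < √(n : ℝ) := Real.sqrt_pos.2 hn0
  have h1 : 4 / (p ^ 2 * m) ≤ 4 * M / p ^ 2 / n := by
    calc 4 / (p ^ 2 * m) ≤ 4 / (p ^ 2 * (n / M)) := by gcongr
      _ = 4 * M / p ^ 2 / n := by field_simp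
  have h2 : √n / √(2 * M / p) ≤ √(p * m / 2) := by
    rw [← Real.sqrt_div hn0.le]
    refine Real.sqrt_le_sqrt ?_
    calc (n : ℝ) / (2 * M / p) = p * (n / M) / 2 := by field_simp
      _ ≤ p * m / 2 := by gcongr
  have hc : 0 < √(2 * M / p) := Real.sqrt_pos.2 (by positivity)
  have h3 : ((⌊δ * √n⌋₊ : ℝ) + 1) / √(p * m / 2) ≤ √(2 * M / p) * δ + √(2 * M / p) / √n := by
    calc ((⌊δ * √n⌋₊ : ℝ) + 1) / √(p * m / 2) ≤ (δ * √n + 1) / (√n / √(2 * M / p)) := by gcongr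
      _ = √(2 * M / p) * δ + √(2 * M / p) / √n := by field_simp
  linarith

/-- Order of choices: `δ` makes the small ball term `a/4`, then `K` makes the second moment per site
less than `δ² a/4`, then `n > N₀` makes the remaining error less than `a/4`. Shorter cycles have at
most `N₀` sites and need only a union bound. -/
theorem noiseStable_cycleMajority (k : ℕ) (T : ℕ → ℕ) :
    NoiseStable fun n : {n : ℕ // Odd n} => cycleMajority k (T n) (n : ℕ) := by
  classical
  refine noiseStable_of_forall fun a ha => ?_
  obtain ⟨c, b, hc, hb, hanti⟩ := exists_uniformProb_abs_totalSum_le k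
  set δ : ℝ := a / (4 * c) with hδ
  have hδ0 : 0 < δ := by positivity
  have hlim : Tendsto (fun n : ℕ => b / (n : ℝ) + c / √n) atTop (𝓝 0) := by
    have h1 := tendsto_const_div_atTop_nhds_zero_nat b
    have h2 : Tendsto (fun n : ℕ => c / √(n : ℝ)) atTop (𝓝 0) :=
      tendsto_const_nhds.div_atTop (Real.tendsto_sqrt_atTop.comp tendsto_natCast_atTop_atTop)
    simpa using h1.add h2
  obtain ⟨N, hN⟩ := eventually_atTop.1 (hlim.eventually_lt_const (show 0 < a / 4 by positivity))
  obtain ⟨K, hK⟩ := ((tendsto_second_moment_bound k).eventually_lt_const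
    (show 0 < δ ^ 2 * (a / 4) by positivity)).exists
  set D : ℝ := 8 * (K + 1) * (2 * K + 1) with hD
  have hD0 : 0 ≤ D := by positivity
  set N₀ := N + 2 * K + 3 * (k + 1) with hN₀
  refine ⟨D / δ ^ 2 + N₀, fun ε h0 h1 n => ?_⟩
  obtain ⟨n, hodd⟩ := n
  have : NeZero n := ⟨hodd.pos.ne'⟩
  by_cases hn : n ≤ N₀
  · refine (disagreement_le_card _ h0.le h1).trans (ENNReal.ofReal_le_ofReal ?_)
    have h2 : (Fintype.card (ZMod n) : ℝ) ≤ N₀ := by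
      rw [ZMod.card]; exact_mod_cast hn
    have h3 : 0 ≤ D / δ ^ 2 * ε := by positivity
    show ε * (Fintype.card (ZMod n) : ℝ) ≤ _
    nlinarith
  · rw [not_le] at hn
    have hn0 : (0 : ℝ) < n := by
      have : 0 < n := by omega
      exact_mod_cast this
    have hsn : 0 < √(n : ℝ) := Real.sqrt_pos.2 hn0
    -- Every flip has weight `D / (δ² n)`, so the `n` sites together contribute `ε D / δ²`,
    -- independent of `n`.
    refine (disagreement_le (f := cycleMajority k (T n) n) (a := a)
      (b := fun _ => D / (δ ^ 2 * n)) h0.le h1 ha.le (fun _ => by positivity)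
      fun η => ?_).trans (ENNReal.ofReal_le_ofReal ?_)
    · refine (uniformProb_cycleMajority_ne_le k (T n) η
        (show 0 < δ * √(n : ℝ) by positivity)).trans ?_
      have h2 := hanti n (by omega) (T n) δ hδ0
      have h3 := hN n (by omega)
      have h4 : c * δ = a / 4 := by rw [hδ]; field_simp
      have h5 := expect_sq_sum_siteChange_le (k := k) (T := T n) (K := K) (by omega) (by omega) η
      have h6 : (δ * √(n : ℝ)) ^ 2 = δ ^ 2 * n := by rw [mul_pow, Real.sq_sqrt hn0.le]
      rw [h6, ← Finset.mul_sum]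
      have h7 : (𝔼 ω, (∑ i, siteChange k (T n) η i ω) ^ 2) / (δ ^ 2 * n) ≤
          a / 4 + D / (δ ^ 2 * n) * ∑ x, if η x = -1 then 1 else 0 := by
        rw [div_le_iff₀ (by positivity)]
        refine h5.trans ?_
        have h8 := mul_le_mul_of_nonneg_left hK.le hn0.le
        have h9 : (a / 4 + D / (δ ^ 2 * n) * ∑ x, if η x = -1 then 1 else 0) * (δ ^ 2 * n) =
            n * (δ ^ 2 * (a / 4)) + D * ∑ x, if η x = -1 then 1 else 0 := by
          field_simp
        rw [h9]
        exact add_le_add_left h8 _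
      linarith
    · rw [Finset.sum_const, Finset.card_univ, ZMod.card, nsmul_eq_mul]
      have h2 : (n : ℝ) * (D / (δ ^ 2 * n)) = D / δ ^ 2 := by field_simp
      rw [h2]
      have : 0 ≤ (N₀ : ℝ) * ε := by positivity
      nlinarith

theorem mainTheorem12 (k : ℕ) (hk : 1 ≤ k) :
    NoiseStable (fun n : ℕ => treeMajority k n) ∧
      ∀ T : ℕ → ℕ, NoiseStable (fun n : {n : ℕ // Odd n} => cycleMajority k (T n) (n : ℕ)) :=
  ⟨noiseStable_treeMajority k, fun T => noiseStable_cycleMajority k T⟩
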